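/- **Setting.** Let $\Theta,\Xi$ be measurable spaces (parameters and noise), $(P_\theta)_{\theta\in\Theta}$ a measurable family (Markov kernel) of probability measures on $\Xi$, and $(\mu_h)_{h\in\mathbb R^k}$ a family of probability measures on $\Theta$ (posteriors indexed by a hyper-parameter). Let $\mathcal S$ be a state set, $\emptyset\neq\mathcal A\subseteq\mathbb R^n$ an action set with the Euclidean norm, $\mathcal C:\mathcal S\times\mathbb R^n\times\Xi\to\mathbb R$ a cost, $g:\mathcal S\times\mathbb R^n\times\Xi\to\mathcal S$ a transition map, $V$ a real function of a state and a posterior (the next-stage value function), $H:\Xi\to\mathbb R^k$ and $\mathrm{Rep}:\mathbb R^k\to\mathbb R^k$ maps, and $\gamma\in\mathbb R$. Fix $s\in\mathcal S$, $h\in\mathbb R^k$ and put $$F(a,\xi)=\mathcal C(s,a,\xi)+\gamma V\bigl(g(s,a,\xi),\mu_{\mathrm{Rep}(h+H(\xi))}\bigr),\qquad G(a,\theta)=\mathbb E_{P_\theta}[F(a,\xi)].$$ For $\alpha\in(0,1)$ let $\vartheta^\alpha$ be the optimal value (infimum) of $$\min_{\kappa\in\mathbb R,\,a\in\mathcal A}\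 \kappa\quad\text{s.t.}\quad \mu_h\{\theta: G(a,\theta)\ge\kappa\}\le\alpha .$$ Draw $N$ independent $\theta_1,\dots,\theta_N\sim\mu_h$ and, given these, independent $\xi^{i,1},\dots,\xi^{i,M}\sim P_{\theta_i}$ for each $i$. Write $\hat G_i(a)=\frac1M\sum_{j=1}^M F(a,\xi^{i,j})$ and let $\vartheta^{N,M,\alpha}$ be the optimal value of the mixed-integer problem $$\min_{\kappa\in\mathbb R,\,a\in\mathcal A,\,z\in\{0,1\}^N}\ \kappa\quad\text{s.t.}\quad -Uz_i+\hat G_i(a)\le\kappa\ (i=1,\dots,N),\quad \sum_{i=1}^N z_i=\lfloor\alpha N\rfloor ,$$ where $U$ is any constant exceeding all differences $\hat G_i(a)-\hat G_{i'}(a')$ with $a,a'\in\mathcal A$ and $1\le i,i'\le N$. Optimal values are taken in $[-\infty,\infty]$. **Assumptions.** (i) For every $a\in\mathcal A$, $F(a,\cdot)$ is measurable and has a finite second moment under every $P_\theta$. (ii) There is $L\ge0$ with $|G(a_1,\theta)-G(a_2,\theta)|\le L\|a_1-a_2\|$ for all $a_1,a_2\in\mathcal A$, $\theta\in\Theta$.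 (iii) There is a measurable $\varphi:\Xi\to[0,\infty)$ with $|F(a_1,\xi)-F(a_2,\xi)|\le\varphi(\xi)\|a_1-a_2\|$ for all $a_1,a_2\in\mathcal A$, $\xi\in\Xi$, and for every $\theta$ the moment generating function of $\varphi(\xi)$ under $P_\theta$ is finite in a neighbourhood of $0$. **Theorem.** For every $\iota>0$ there are constants $\varsigma,\upsilon>0$, depending only on the data above (the objective, $\mathcal A$, $(P_\theta)$, $\mu_h$) and on $\iota$, such that the following holds for all $D$ with $D\ge\|a\|$ for every $a\in\mathcal A$, all $\alpha$ with $\iota<\alpha<1-\iota$, all $\epsilon,\varepsilon\in(0,1)$ and all $\eta,\delta>0$. Put $$N_0=\frac{2}{\iota^2}\Bigl[\log\frac1\epsilon+n\log\Bigl\lceil\frac{2LD}{\eta}\Bigr\rceil+n\log\Bigl\lceil\frac2\iota\Bigr\rceil\Bigr],\qquad M_0=\frac{8\varsigma^2}{\delta^2}\Bigl[\log\Bigl(1+\frac{D^n}{\upsilon^n}\Bigr)+\log\frac1\varepsilon\Bigr]$$ (with $\log 0$ read as $0$ if $LD=0$). Then for all integers $N\ge N_0$ and $M\ge M_0$, with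 probability at least $1-2\epsilon-2\varepsilon$, $$\vartheta^{N,M,\alpha+\iota}-\delta\ \le\ \vartheta^{\alpha}\ \le\ \vartheta^{N,M,\alpha-\iota}+\delta+\eta$$ (for every admissible $U$). -/

import Mathlib

open MeasureTheory ProbabilityTheory

noncomputable section

namespace BCR

/-- The one-stage cost `C(s,a,ξ) + γ V(s', μ_{h'})` with `s' = g(s,a,ξ)` and
`h' = Rep(h + H(ξ))`, at a fixed state `s` and a fixed hyper-parameter `h`.
`V` is the (next-stage) value function, `μ` maps a hyper-parameter to the posterior law of the
model parameter, and `Rep` is the projection onto the representative hyper-parameters. -/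
def stageCost {S Θ Ξ : Type*} [MeasurableSpace Θ] {n k : ℕ}
    (C : S → EuclideanSpace ℝ (Fin n) → Ξ → ℝ)
    (g : S → EuclideanSpace ℝ (Fin n) → Ξ → S)
    (V : S → ProbabilityMeasure Θ → ℝ)
    (μ : EuclideanSpace ℝ (Fin k) → ProbabilityMeasure Θ)
    (H : Ξ → EuclideanSpace ℝ (Fin k))
    (Rep : EuclideanSpace ℝ (Fin k) → EuclideanSpace ℝ (Fin k))
    (γ : ℝ) (s : S) (h : EuclideanSpace ℝ (Fin k))
    (a : EuclideanSpace ℝ (Fin n)) (ξ : Ξ) : ℝ :=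
  C s a ξ + γ * V (g s a ξ) (μ (Rep (h + H ξ)))

/-- The inner expectation `𝔼_{P_θ}[F(a,ξ)]`. -/
def expectedCost {E Θ Ξ : Type*} [MeasurableSpace Θ] [MeasurableSpace Ξ]
    (F : E → Ξ → ℝ) (P : Kernel Θ Ξ) (a : E) (θ : Θ) : ℝ :=
  ∫ ξ, F a ξ ∂(P θ)

/-- The optimal value of the chance-constrained problem: minimize `κ` over `κ ∈ ℝ`, `a ∈ A`
subject to `Q(𝔼_{P_θ}[F(a,ξ)] ≥ κ) ≤ α`. -/
def trueValue {E Θ Ξ : Type*} [MeasurableSpace Θ] [MeasurableSpace Ξ]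
    (A : Set E) (F : E → Ξ → ℝ) (P : Kernel Θ Ξ) (Q : Measure Θ) (α : ℝ) : EReal :=
  sInf ((fun κ : ℝ => (κ : EReal)) ''
    {κ : ℝ | ∃ a ∈ A, Q {θ | κ ≤ expectedCost F P a θ} ≤ ENNReal.ofReal α})

/-- The inner sample average `(1/M) ∑_j F(a, ξ^j)`. -/
def sampleMean {E Ξ : Type*} {M : ℕ} (F : E → Ξ → ℝ) (x : Fin M → Ξ) (a : E) : ℝ :=
  (∑ j, F a (x j)) / M

/-- `U` exceeds every difference of two values of the sample averages that occur in the
constraints of the mixed-integer problem, so it is an admissible big-M constant. -/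
def IsBigM {E Ξ : Type*} {N M : ℕ} (A : Set E) (F : E → Ξ → ℝ)
    (x : Fin N → Fin M → Ξ) (U : ℝ) : Prop :=
  ∀ a ∈ A, ∀ a' ∈ A, ∀ i i' : Fin N, sampleMean F (x i) a - sampleMean F (x i') a' < U

/-- The optimal value of the two-level sample average approximation, the mixed-integer problem:
minimize `κ` over `κ ∈ ℝ`, `a ∈ A`, `z ∈ {0,1}^N` subject to
`-U z_i + (1/M) ∑_j F(a, ξ^{i,j}) ≤ κ` for all `i`, and `∑ z_i = ⌊α N⌋`. -/
def saaValue {E Ξ : Type*} {N M : ℕ} (A : Set E) (F : E → Ξ → ℝ)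
    (x : Fin N → Fin M → Ξ) (U α : ℝ) : EReal :=
  sInf ((fun κ : ℝ => (κ : EReal)) ''
    {κ : ℝ | ∃ a ∈ A, ∃ z : Fin N → ℝ, (∀ i, z i = 0 ∨ z i = 1) ∧
      (∀ i, -U * z i + sampleMean F (x i) a ≤ κ) ∧ ∑ i, z i = (⌊α * N⌋ : ℝ)})

/-- `θ ↦ P_θ ⊗ ⋯ ⊗ P_θ` (`M` factors): the law of `M` i.i.d. draws from `P_θ`. -/
def iidKernel {Θ Ξ : Type*} [MeasurableSpace Θ] [MeasurableSpace Ξ]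
    (P : Kernel Θ Ξ) [IsMarkovKernel P] (M : ℕ) : Kernel Θ (Fin M → Ξ) where
  toFun θ := Measure.pi fun _ => P θ
  measurable' := by
    refine Measurable.measure_of_isPiSystem_of_isProbabilityMeasure
      generateFrom_pi.symm isPiSystem_pi ?_
    rintro _ ⟨s, hs, rfl⟩
    simp only [Measure.pi_pi]
    exact Finset.measurable_prod _ fun i _ => P.measurable_coe (hs i (Set.mem_univ i))

/-- The law of the nested sample: `N` independent pairs `(θ_i, (ξ^{i,1}, …, ξ^{i,M}))`, where
`θ_i` has law `Q` and, given `θ_i`, the `ξ^{i,j}` are i.i.d. with law `P_{θ_i}`. -/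
def nestedSampleLaw {Θ Ξ : Type*} [MeasurableSpace Θ] [MeasurableSpace Ξ]
    (P : Kernel Θ Ξ) [IsMarkovKernel P] (Q : Measure Θ) (N M : ℕ) :
    Measure (Fin N → Θ × (Fin M → Ξ)) :=
  Measure.pi fun _ => Q ⊗ₘ iidKernel P M

/-- The event `B` holds with probability at least `p`: it contains a measurable event of
probability at least `p`. -/
def HoldsWithProbAtLeast {X : Type*} [MeasurableSpace X] (m : Measure X) (p : ℝ)
    (B : Set X) : Prop :=
  ∃ B' : Set X, MeasurableSet B' ∧ B' ⊆ B ∧ ENNReal.ofReal p ≤ m B'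

/-- The outer sample size
`N₀ = (2/ι²) [log(1/ε) + n log ⌈2LD/η⌉ + n log ⌈2/ι⌉]`. -/
def outerSampleSize (n : ℕ) (L D η ι ε : ℝ) : ℝ :=
  2 / ι ^ 2 * (Real.log (1 / ε) + n * Real.log (⌈2 * L * D / η⌉ : ℝ)
    + n * Real.log (⌈2 / ι⌉ : ℝ))

/-- The inner sample size
`M₀ = (8ς²/δ²) [log(1 + Dⁿ/υⁿ) + log(1/ε')]`. -/
def innerSampleSize (n : ℕ) (ς υ D δ ε' : ℝ) : ℝ :=
  8 * ς ^ 2 / δ ^ 2 * (Real.log (1 + D ^ n / υ ^ n) + Real.log (1 / ε'))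

end BCR

end

/-! The inner sampling error need not be small for all `N` outer samples at once. It is enough that
it is small off an event `W` for a single pair `(θ, x)` whose probability is at most `ι / 2`.
Samples falling in `W` are charged to the risk level, and the remaining `ι / 2` pays for the
fluctuation of empirical frequencies.

Inner level (`exists_uniform_deviation_bound`): the moments of `φ` are finite for each `θ` but not
uniformly in `θ`. Discarding parameters of small prior mass makes them uniform. Chaining along
dyadic nets of `A` then bounds all deviations of sample means by `B / √M`, with `B` independent of
`M`. So `ς = B` and `υ = 1` work: the inner sample size forces `B / √M ≤ δ / 2`.

Outer level (`holdsWithProbAtLeast_saaValue`): with an admissible `U`, the mixed-integer constraints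
say that at most `⌊αN⌋` sample means exceed `κ`. For the lower estimate, a nearly optimal `(κ₀, a₁)`
is deterministic, so one application of Hoeffding's inequality makes `κ₀ + δ / 2` feasible at level
`α + ι`. For the upper estimate the sampled action is random. It is replaced by a point of an
`η`-fine net, where Hoeffding's inequality and a union bound compare empirical frequencies with the
quantiles of the expected cost. Each estimate fails with probability at most `ε`. -/

/-! ### Packing and nets in Euclidean balls. -/

/-- A finite `r`-separated subset of a ball of radius `D` has at most `(1 + 2D/r)^n` points. -/
lemma card_le_of_separated_of_norm_le {n : ℕ} {D r : ℝ} (hD : 0 ≤ D) (hr : 0 < r)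
    (T : Finset (EuclideanSpace ℝ (Fin n))) (hT : ∀ a ∈ T, ‖a‖ ≤ D)
    (hsep : ∀ a ∈ T, ∀ b ∈ T, a ≠ b → r ≤ dist a b) :
    (T.card : ℝ) ≤ (1 + 2 * D / r) ^ n := by
  have hρ : 0 < D + r / 2 := by positivity
  have hdisj : (T : Set (EuclideanSpace ℝ (Fin n))).PairwiseDisjoint
      fun c => Metric.ball c (r / 2) := by
    intro a ha b hb hab
    apply Metric.ball_disjoint_ball
    linarith [hsep a ha b hb hab]
  have hsub : (⋃ c ∈ T, Metric.ball c (r / 2)) ⊆ Metric.ball 0 (D + r / 2) := by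
    refine Set.iUnion₂_subset fun x hx => Metric.ball_subset_ball' ?_
    rw [dist_zero_right]
    linarith [hT x hx]
  set ν : Measure (EuclideanSpace ℝ (Fin n)) := volume
  have hvol : (T.card : ENNReal) * ENNReal.ofReal ((r / 2) ^ n) * ν (Metric.ball 0 1) ≤
      ENNReal.ofReal ((D + r / 2) ^ n) * ν (Metric.ball 0 1) :=
    calc
      _ = ν (⋃ c ∈ T, Metric.ball c (r / 2)) := by
        rw [measure_biUnion_finset hdisj fun c _ => measurableSet_ball]
        simp only [ν.addHaar_ball_of_pos _ (half_pos hr), finrank_euclideanSpace_fin]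
        simp only [Finset.sum_const, nsmul_eq_mul, mul_assoc]
      _ ≤ ν (Metric.ball 0 (D + r / 2)) := measure_mono hsub
      _ = _ := by
        simp only [ν.addHaar_ball_of_pos _ hρ, finrank_euclideanSpace_fin]
  have hcard : (T.card : ENNReal) * ENNReal.ofReal ((r / 2) ^ n) ≤
      ENNReal.ofReal ((D + r / 2) ^ n) :=
    (ENNReal.mul_le_mul_iff_left (Metric.measure_ball_pos _ _ zero_lt_one).ne'
      measure_ball_lt_top.ne).1 hvol
  have hreal := ENNReal.toReal_le_of_le_ofReal (by positivity) hcard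
  rw [ENNReal.toReal_mul, ENNReal.toReal_natCast, ENNReal.toReal_ofReal (by positivity)] at hreal
  have hsplit : (1 + 2 * D / r) ^ n * (r / 2) ^ n = (D + r / 2) ^ n := by
    rw [← mul_pow]
    congr 1
    field_simp
    ring
  rw [← hsplit] at hreal
  exact le_of_mul_le_mul_right hreal (by positivity)

/-- A subset of a ball of radius `D` has an inner `r`-net with at most `(1 + 2D/r)^n` points. -/
lemma exists_finset_net {n : ℕ} {D r : ℝ} (hD : 0 ≤ D) (hr : 0 < r)
    (A : Set (EuclideanSpace ℝ (Fin n))) (hA : ∀ a ∈ A, ‖a‖ ≤ D) :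
    ∃ T : Finset (EuclideanSpace ℝ (Fin n)), (∀ b ∈ T, b ∈ A) ∧
      (∀ a ∈ A, ∃ b ∈ T, dist a b ≤ r) ∧ (T.card : ℝ) ≤ (1 + 2 * D / r) ^ n := by
  classical
  let p : ℕ → Prop := fun m => ∃ T : Finset (EuclideanSpace ℝ (Fin n)), (∀ b ∈ T, b ∈ A) ∧
    (∀ a ∈ T, ∀ b ∈ T, a ≠ b → r ≤ dist a b) ∧ T.card = m
  have hp0 : p 0 := ⟨∅, by simp⟩
  have hbound : ∀ m, p m → m ≤ ⌊(1 + 2 * D / r) ^ n⌋₊ := by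
    rintro m ⟨T, hTA, hsep, rfl⟩
    exact Nat.le_floor
      (card_le_of_separated_of_norm_le hD hr T (fun a ha => hA a (hTA a ha)) hsep)
  -- The packing bound makes a largest separated set exist; it is a net, since a point farther than
  -- `r` from it could be added.
  obtain ⟨T, hTA, hsep, hcard⟩ := Nat.findGreatest_spec (P := p)
    (Nat.zero_le ⌊(1 + 2 * D / r) ^ n⌋₊) hp0
  refine ⟨T, hTA, fun a ha => ?_,
    card_le_of_separated_of_norm_le hD hr T (fun a ha => hA a (hTA a ha)) hsep⟩
  by_contra! hfar
  have haT : a ∉ T := fun h => by simpa using (hr.trans (hfar a h))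
  have hins : p (insert a T).card := by
    refine ⟨insert a T, fun b hb => ?_, fun b hb c hc hbc => ?_, rfl⟩
    · rcases Finset.mem_insert.1 hb with rfl | hb
      exacts [ha, hTA b hb]
    · rcases Finset.mem_insert.1 hb with hb | hb <;> rcases Finset.mem_insert.1 hc with hc | hc
      · exact absurd (hb.trans hc.symm) hbc
      · exact hb ▸ (hfar c hc).le
      · rw [dist_comm]
        exact hc ▸ (hfar b hb).le
      · exact hsep b hb c hc hbc
  have hle := Nat.le_findGreatest (hbound _ hins) hins
  rw [Finset.card_insert_of_notMem haT] at hle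
  omega

lemma one_add_le_two_mul_ceil {x : ℝ} (hx : 0 < x) : 1 + x ≤ 2 * (⌈x⌉ : ℝ) := by
  have h1 : (1 : ℝ) ≤ ⌈x⌉ := by exact_mod_cast Int.one_le_ceil_iff.2 hx
  linarith [Int.le_ceil x]

/-- The net over which the union bound runs: its size is controlled by the outer sample size. -/
lemma exists_finset_lipschitz_net {n : ℕ} {D L η ι : ℝ} (hL : 0 ≤ L) (hη : 0 < η) (hι : 0 < ι)
    (hι1 : ι ≤ 1) (A : Set (EuclideanSpace ℝ (Fin n))) (hne : A.Nonempty)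
    (hA : ∀ a ∈ A, ‖a‖ ≤ D) :
    ∃ T : Finset (EuclideanSpace ℝ (Fin n)), T.Nonempty ∧ (∀ b ∈ T, b ∈ A) ∧
      (∀ a ∈ A, ∃ b ∈ T, L * ‖a - b‖ ≤ η) ∧
      Real.log T.card ≤ n * Real.log (⌈2 * L * D / η⌉ : ℝ) + n * Real.log (⌈2 / ι⌉ : ℝ) := by
  obtain ⟨a₀, ha₀⟩ := hne
  have hD : 0 ≤ D := (norm_nonneg _).trans (hA a₀ ha₀)
  -- This factor absorbs the `2` in `1 + x ≤ 2⌈x⌉`.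
  have h2 : (2 : ℝ) ≤ ⌈2 / ι⌉ := by
    refine le_trans ?_ (Int.le_ceil _)
    rw [le_div_iff₀ hι]
    linarith
  -- If `LD = 0`, the first logarithm is `Real.log 0 = 0`. A one-point net suffices, because either
  -- `L = 0` or `A = {0}`.
  rcases (mul_nonneg hL hD).eq_or_lt with h0 | hpos
  · refine ⟨{a₀}, by simp, by simpa using ha₀, fun a ha => ⟨a₀, by simp, ?_⟩, ?_⟩
    · rcases mul_eq_zero.1 h0.symm with h | h
      · rw [h, zero_mul]
        exact hη.le
      · have hz : ∀ b ∈ A, b = 0 := fun b hb => by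
          simpa [h] using hA b hb
        rw [hz a ha, hz a₀ ha₀]
        simpa using hη.le
    · have h0' : 2 * L * D / η = 0 := by rw [mul_assoc, ← h0]; simp
      rw [h0']
      have : 0 ≤ n * Real.log (⌈2 / ι⌉ : ℝ) :=
        mul_nonneg (Nat.cast_nonneg n) (Real.log_nonneg (by linarith))
      simpa using this
  · have hLpos : 0 < L := hL.lt_of_ne (fun h => by simp [← h] at hpos)
    have hDpos : 0 < D := hD.lt_of_ne (fun h => by simp [← h] at hpos)
    obtain ⟨T, hTA, hnet, hcard⟩ := exists_finset_net hD (div_pos hη hLpos) A hA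
    have hTne : T.Nonempty := by
      obtain ⟨b, hb, -⟩ := hnet a₀ ha₀
      exact ⟨b, hb⟩
    refine ⟨T, hTne, hTA, fun a ha => ?_, ?_⟩
    · obtain ⟨b, hb, hab⟩ := hnet a ha
      refine ⟨b, hb, ?_⟩
      rw [dist_eq_norm, le_div_iff₀ hLpos] at hab
      linarith
    · have hx : 0 < 2 * L * D / η := by positivity
      have hx1 : (1 : ℝ) ≤ ⌈2 * L * D / η⌉ := by exact_mod_cast Int.one_le_ceil_iff.2 hx
      have heq : 1 + 2 * D / (η / L) = 1 + 2 * L * D / η := by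
        field_simp
      rw [heq] at hcard
      have hle : (T.card : ℝ) ≤ ((⌈2 * L * D / η⌉ : ℝ) * (⌈2 / ι⌉ : ℝ)) ^ n := by
        refine hcard.trans (pow_le_pow_left₀ (by positivity) ?_ n)
        refine (one_add_le_two_mul_ceil hx).trans ?_
        rw [mul_comm]
        exact mul_le_mul_of_nonneg_left h2 (by linarith)
      have hcpos : (0 : ℝ) < T.card := by exact_mod_cast hTne.card_pos
      refine (Real.log_le_log hcpos hle).trans ?_
      rw [Real.log_pow, Real.log_mul (by positivity) (by positivity), mul_add]

/-! ### Concentration for i.i.d. samples. -/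

/-- Hoeffding's inequality for the number of sample points that fall into an event. -/
lemma measureReal_pi_le_sum_indicator_le {X : Type*} [MeasurableSpace X] (ν : Measure X)
    [IsProbabilityMeasure ν] {E : Set X} (hE : MeasurableSet E) {q c : ℝ} (hq : ν.real E ≤ q)
    (hc : 0 ≤ c) {N : ℕ} (hN : 0 < N) :
    (Measure.pi fun _ : Fin N => ν).real
      {ω | (q + c) * N ≤ ∑ i, E.indicator (fun _ => (1 : ℝ)) (ω i)} ≤
      Real.exp (-2 * N * c ^ 2) := by
  set f : X → ℝ := E.indicator fun _ => (1 : ℝ) with hf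
  have hfm : Measurable f := measurable_const.indicator hE
  have hint : ∫ x, f x ∂ν = ν.real E := by
    rw [hf, integral_indicator hE]
    simp
  -- Hoeffding's lemma: a centred variable with values in an interval of length `1` has sub-Gaussian
  -- parameter `1 / 4`, whence the exponent `-2Nc²`.
  have hsub : HasSubgaussianMGF (fun x => f x - ∫ x, f x ∂ν) ((‖(1 : ℝ) - 0‖₊ / 2) ^ 2) ν := by
    refine hasSubgaussianMGF_of_mem_Icc hfm.aemeasurable (ae_of_all _ fun x => ?_)
    by_cases hx : x ∈ E <;> simp [hf, hx]
  have hpi : ∀ i ∈ (Finset.univ : Finset (Fin N)),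
      HasSubgaussianMGF (fun ω : Fin N → X => f (ω i) - ∫ x, f x ∂ν)
        ((‖(1 : ℝ) - 0‖₊ / 2) ^ 2) (Measure.pi fun _ : Fin N => ν) := by
    intro i _
    refine HasSubgaussianMGF.of_map (Y := fun ω : Fin N → X => ω i)
      (X := fun x => f x - ∫ x, f x ∂ν) (measurable_pi_apply i).aemeasurable ?_
    rw [(measurePreserving_eval (fun _ : Fin N => ν) i).map_eq]
    exact hsub
  have hindep : iIndepFun (fun (i : Fin N) (ω : Fin N → X) => f (ω i) - ∫ x, f x ∂ν)
      (Measure.pi fun _ : Fin N => ν) :=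
    iIndepFun_pi (X := fun _ x => f x - ∫ x, f x ∂ν)
      fun _ => (hfm.sub_const _).aemeasurable
  have key := HasSubgaussianMGF.measure_sum_ge_le_of_iIndepFun hindep hpi
    (ε := c * N) (by positivity)
  refine (measureReal_mono (fun ω hω => ?_)).trans (key.trans (le_of_eq ?_))
  · simp only [Set.mem_ofPred_eq, Finset.sum_sub_distrib, Finset.sum_const, Finset.card_univ,
      Fintype.card_fin, nsmul_eq_mul, hint] at hω ⊢
    have := mul_le_mul_of_nonneg_left hq (Nat.cast_nonneg (α := ℝ) N)
    nlinarith
  · have hN' : (N : ℝ) ≠ 0 := by positivity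
    congr 1
    simp
    field_simp

/-- The second-order Taylor remainder is at most `(τy)² exp |τy|`, and `y² ≤ 2 exp |y|`. Factoring
out `τ²` leaves an exponential moment independent of `τ`, so `M`-th powers stay bounded when `Mτ² =
1`. -/
lemma exp_mul_le_one_add {τ y : ℝ} (h0 : 0 ≤ τ) (h1 : τ ≤ 1) :
    Real.exp (τ * y) ≤ 1 + τ * y + τ ^ 2 * (2 * Real.exp (2 * |y|)) := by
  have h := Complex.norm_exp_sub_sum_le_norm_mul_exp ((τ * y : ℝ) : ℂ) 2
  have hs : ∑ m ∈ Finset.range 2, ((τ * y : ℝ) : ℂ) ^ m / (m.factorial : ℂ)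
      = ((1 + τ * y : ℝ) : ℂ) := by
    simp [Finset.sum_range_succ]
  rw [hs, ← Complex.ofReal_exp, ← Complex.ofReal_sub, Complex.norm_real, Complex.norm_real,
    Real.norm_eq_abs, Real.norm_eq_abs, sq_abs, abs_mul, abs_of_nonneg h0] at h
  have hle := (le_abs_self _).trans h
  have he : Real.exp (τ * |y|) ≤ Real.exp |y| :=
    Real.exp_le_exp.2 (mul_le_of_le_one_left (abs_nonneg y) h1)
  have hq : y ^ 2 ≤ 2 * Real.exp |y| := by
    have := Real.quadratic_le_exp_of_nonneg (abs_nonneg y)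
    rw [sq_abs] at this
    linarith [abs_nonneg y]
  have h2 : Real.exp (2 * |y|) = Real.exp |y| * Real.exp |y| := by
    rw [← Real.exp_add]
    ring_nf
  have : (τ * y) ^ 2 * Real.exp (τ * |y|) ≤ τ ^ 2 * (2 * Real.exp (2 * |y|)) := by
    rw [h2, mul_pow, mul_assoc]
    refine mul_le_mul_of_nonneg_left ?_ (sq_nonneg τ)
    calc y ^ 2 * Real.exp (τ * |y|) ≤ (2 * Real.exp |y|) * Real.exp |y| :=
          mul_le_mul hq he (Real.exp_pos _).le (by positivity)
      _ = _ := by ring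
  linarith

/-- A centred sum of `M` sub-exponential variables has an exponential tail at scale `√M`. -/
lemma measureReal_pi_le_sum_le_exp {X : Type*} [MeasurableSpace X] (ν : Measure X)
    [IsProbabilityMeasure ν] {y : X → ℝ} (hy : Measurable y)
    (hint : Integrable (fun x => Real.exp (2 * |y x|)) ν) (hmean : ∫ x, y x ∂ν = 0) {K : ℝ}
    (hK : ∫ x, Real.exp (2 * |y x|) ∂ν ≤ K) {M : ℕ} (hM : 0 < M) (u : ℝ) :
    (Measure.pi fun _ : Fin M => ν).real {x | u * √M ≤ ∑ j, y (x j)} ≤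
      Real.exp (2 * K - u) := by
  have hMpos : (0 : ℝ) < M := by positivity
  have hsM : 0 < √(M : ℝ) := Real.sqrt_pos.2 hMpos
  -- Chernoff parameter: `Mτ² = 1` bounds the `M`-th power of the moment generating function by `exp
  -- (2K)`, while the threshold `u√M` contributes `exp (-u)`.
  set τ : ℝ := 1 / √M with hτ
  have hτ0 : 0 ≤ τ := by positivity
  have hτ1 : τ ≤ 1 := by
    rw [hτ, div_le_one hsM, Real.one_le_sqrt]
    exact_mod_cast hM
  have hτM : M * τ ^ 2 = 1 := by
    rw [hτ, div_pow, Real.sq_sqrt hMpos.le]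
    field_simp
  have hyint : Integrable y ν := by
    refine hint.mono' hy.aestronglyMeasurable (ae_of_all _ fun x => ?_)
    rw [Real.norm_eq_abs]
    linarith [Real.add_one_le_exp (2 * |y x|), abs_nonneg (y x)]
  have hexpint : Integrable (fun x => Real.exp (τ * y x)) ν := by
    refine hint.mono' (hy.const_mul τ).exp.aestronglyMeasurable (ae_of_all _ fun x => ?_)
    rw [Real.norm_eq_abs, Real.abs_exp, Real.exp_le_exp]
    calc τ * y x ≤ τ * |y x| := mul_le_mul_of_nonneg_left (le_abs_self _) hτ0
      _ ≤ 2 * |y x| := mul_le_mul_of_nonneg_right (by linarith) (abs_nonneg _)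
  have hmgf1 : mgf y ν τ ≤ Real.exp (τ ^ 2 * (2 * K)) := by
    have h1 : mgf y ν τ ≤ ∫ x, (1 + τ * y x + τ ^ 2 * (2 * Real.exp (2 * |y x|))) ∂ν :=
      integral_mono hexpint
        (((integrable_const _).add (hyint.const_mul τ)).add ((hint.const_mul 2).const_mul _))
        fun x => exp_mul_le_one_add hτ0 hτ1
    rw [integral_add (f := fun x => 1 + τ * y x) ((integrable_const _).add (hyint.const_mul τ))
      ((hint.const_mul 2).const_mul _), integral_add (integrable_const _) (hyint.const_mul τ),
      integral_const_mul, integral_const_mul, integral_const_mul, hmean] at h1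
    simp only [integral_const, probReal_univ, smul_eq_mul, mul_zero, add_zero, one_mul] at h1
    have h2 : τ ^ 2 * (2 * ∫ x, Real.exp (2 * |y x|) ∂ν) ≤ τ ^ 2 * (2 * K) := by gcongr
    linarith [Real.add_one_le_exp (τ ^ 2 * (2 * K))]
  have hmeas : ∀ i : Fin M, Measurable fun x : Fin M → X => y (x i) :=
    fun i => hy.comp (measurable_pi_apply i)
  have hindep : iIndepFun (fun (i : Fin M) (x : Fin M → X) => y (x i))
      (Measure.pi fun _ : Fin M => ν) :=
    iIndepFun_pi (X := fun _ => y) fun _ => hy.aemeasurable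
  have heval := fun i => measurePreserving_eval (fun _ : Fin M => ν) i
  have hmgfi : ∀ i : Fin M,
      mgf (fun x : Fin M → X => y (x i)) (Measure.pi fun _ : Fin M => ν) τ = mgf y ν τ := by
    intro i
    exact integral_comp_eval (μ := fun _ : Fin M => ν)
      (hy.const_mul τ).exp.aestronglyMeasurable
  have hinti : ∀ i : Fin M, Integrable (fun x : Fin M → X => Real.exp (τ * y (x i)))
      (Measure.pi fun _ : Fin M => ν) :=
    fun i => (heval i).integrable_comp_of_integrable hexpint
  have hsumint := hindep.integrable_exp_mul_sum hmeas (s := Finset.univ) fun i _ => hinti i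
  have hcher := measure_ge_le_exp_mul_mgf (u * √M) hτ0 hsumint
  rw [hindep.mgf_sum hmeas, Finset.prod_congr rfl fun i _ => hmgfi i, Finset.prod_const,
    Finset.card_univ, Fintype.card_fin] at hcher
  have hpow : mgf y ν τ ^ M ≤ Real.exp (2 * K) := by
    refine (pow_le_pow_left₀ mgf_nonneg hmgf1 M).trans (le_of_eq ?_)
    rw [← Real.exp_nat_mul, ← mul_assoc, hτM, one_mul]
  have hτu : -τ * (u * √M) = -u := by
    rw [hτ]
    field_simp
  simp only [Finset.sum_apply] at hcher
  refine hcher.trans ?_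
  rw [hτu, sub_eq_neg_add, Real.exp_add]
  exact mul_le_mul_of_nonneg_left hpow (Real.exp_pos _).le

/-- Two-sided tail bound for the sample mean of a function dominated by a multiple of `φ`, where
`φ / m` has an exponential moment at most `m`. -/
lemma measureReal_pi_sampleMean_dev_le {X : Type*} [MeasurableSpace X] (ν : Measure X)
    [IsProbabilityMeasure ν] {φ : X → ℝ} (hφ : Measurable φ) (hφ0 : ∀ x, 0 ≤ φ x) {m : ℝ}
    (hm : 0 < m) (hint : Integrable (fun x => Real.exp (φ x / m)) ν)
    (hle : ∫ x, Real.exp (φ x / m) ∂ν ≤ m) {f : X → ℝ} (hf : Measurable f) {r : ℝ} (hr : 0 < r)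
    (hfφ : ∀ x, |f x| ≤ φ x * r) {M : ℕ} (hM : 0 < M) (u : ℝ) :
    (Measure.pi fun _ : Fin M => ν).real
      {x | u * (2 * m * r) / √M ≤ |(∑ j, f (x j)) / M - ∫ x, f x ∂ν|} ≤
      2 * Real.exp (2 * (m * Real.exp m) - u) := by
  have hMpos : (0 : ℝ) < M := by positivity
  have hsM : 0 < √(M : ℝ) := Real.sqrt_pos.2 hMpos
  have hφint : Integrable φ ν := by
    refine (hint.const_mul m).mono' hφ.aestronglyMeasurable (ae_of_all _ fun x => ?_)
    rw [Real.norm_eq_abs, abs_of_nonneg (hφ0 x)]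
    have := Real.add_one_le_exp (φ x / m)
    calc φ x = m * (φ x / m) := by field_simp
      _ ≤ _ := mul_le_mul_of_nonneg_left (by linarith) hm.le
  have hfint : Integrable f ν :=
    (hφint.mul_const r).mono' hf.aestronglyMeasurable (ae_of_all _ hfφ)
  have hEφ : (∫ x, φ x ∂ν) / m ≤ m := by
    rw [← integral_div]
    refine (integral_mono (hφint.div_const m) hint fun x => ?_).trans hle
    linarith [Real.add_one_le_exp (φ x / m)]
  have hEf : |∫ x, f x ∂ν| ≤ (∫ x, φ x ∂ν) * r := by
    rw [← integral_mul_const]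
    exact (abs_integral_le_integral_abs).trans
      (integral_mono hfint.abs (hφint.mul_const r) hfφ)
  -- Since `|f - 𝔼f| ≤ (φ + 𝔼φ) r` and `𝔼φ ≤ m²`, this scaling gives `2|y| ≤ φ / m + m`, hence the
  -- exponential moment bound `m * exp m`.
  set y : X → ℝ := fun x => (f x - ∫ x, f x ∂ν) / (2 * m * r) with hydef
  have hy : Measurable y := (hf.sub_const _).div_const _
  have hybound : ∀ x, 2 * |y x| ≤ φ x / m + m := by
    intro x
    have h1 : |f x - ∫ x, f x ∂ν| ≤ (φ x + ∫ x, φ x ∂ν) * r := by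
      have := abs_sub (f x) (∫ x, f x ∂ν)
      linarith [hfφ x, hEf]
    have h2 : 2 * |y x| = |f x - ∫ x, f x ∂ν| / (m * r) := by
      rw [hydef]
      simp only [abs_div]
      rw [abs_of_pos (by positivity : 0 < 2 * m * r)]
      field_simp
    rw [h2, div_le_iff₀ (by positivity)]
    refine h1.trans ?_
    have h3 : (∫ x, φ x ∂ν) ≤ m * m := by rwa [div_le_iff₀ hm] at hEφ
    have h4 : (φ x / m + m) * (m * r) = (φ x + m * m) * r := by field_simp
    rw [h4]
    gcongr
  have hexp : ∀ x, Real.exp (2 * |y x|) ≤ Real.exp (φ x / m) * Real.exp m := fun x => by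
    rw [← Real.exp_add]
    exact Real.exp_le_exp.2 (hybound x)
  have hyexp : Integrable (fun x => Real.exp (2 * |y x|)) ν := by
    refine (hint.mul_const (Real.exp m)).mono' (by fun_prop) (ae_of_all _ fun x => ?_)
    rw [Real.norm_eq_abs, Real.abs_exp]
    exact hexp x
  have hyK : ∫ x, Real.exp (2 * |y x|) ∂ν ≤ m * Real.exp m := by
    refine (integral_mono hyexp (hint.mul_const _) hexp).trans ?_
    rw [integral_mul_const]
    gcongr
  have hymean : ∫ x, y x ∂ν = 0 := by
    rw [hydef, integral_div, integral_sub hfint (integrable_const _)]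
    simp
  have hpos := measureReal_pi_le_sum_le_exp ν hy hyexp hymean hyK hM u
  have hneg := measureReal_pi_le_sum_le_exp ν (y := fun x => -y x) hy.neg (by simpa using hyexp)
    (by rw [integral_neg, hymean, neg_zero]) (by simpa using hyK) hM u
  have hsub : {x : Fin M → X | u * (2 * m * r) / √M ≤ |(∑ j, f (x j)) / M - ∫ x, f x ∂ν|} ⊆
      {x | u * √M ≤ ∑ j, y (x j)} ∪ {x | u * √M ≤ ∑ j, -y (x j)} := by
    intro x hx
    have hsum : ∑ j, y (x j) = ((∑ j, f (x j)) / M - ∫ x, f x ∂ν) * M / (2 * m * r) := by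
      rw [hydef]
      simp only
      rw [← Finset.sum_div, Finset.sum_sub_distrib]
      simp only [Finset.sum_const, Finset.card_univ, Fintype.card_fin, nsmul_eq_mul]
      field_simp
    have hkey : u * √M ≤ |∑ j, y (x j)| := by
      rw [hsum, abs_div, abs_mul, abs_of_pos hMpos, abs_of_pos (by positivity : 0 < 2 * m * r),
        le_div_iff₀ (by positivity)]
      have hx' : u * (2 * m * r) / √M ≤ |(∑ j, f (x j)) / M - ∫ x, f x ∂ν| := hx
      rw [div_le_iff₀ hsM] at hx'
      have := mul_le_mul_of_nonneg_right hx' hsM.le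
      rw [mul_assoc _ √(M : ℝ), Real.mul_self_sqrt hMpos.le] at this
      linarith
    rcases le_abs.1 hkey with h | h
    · exact Or.inl h
    · right
      simpa using h
  calc _ ≤ _ := measureReal_mono hsub
    _ ≤ _ := measureReal_union_le _ _
    _ ≤ _ := by linarith

/-- Chebyshev's inequality for the sample mean. -/
lemma measureReal_pi_sampleMean_dev_le_div_sq {X : Type*} [MeasurableSpace X] (ν : Measure X)
    [IsProbabilityMeasure ν] {f : X → ℝ} (hf : MemLp f 2 ν) {m : ℝ}
    (hm : ∫ x, f x ^ 2 ∂ν ≤ m) {M : ℕ} (hM : 0 < M) {u : ℝ} (hu : 0 < u) :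
    (Measure.pi fun _ : Fin M => ν).real
      {x | u / √M ≤ |(∑ j, f (x j)) / M - ∫ x, f x ∂ν|} ≤ m / u ^ 2 := by
  have hMpos : (0 : ℝ) < M := by positivity
  have hsM : 0 < √(M : ℝ) := Real.sqrt_pos.2 hMpos
  have heval := fun i => measurePreserving_eval (fun _ : Fin M => ν) i
  have hLp : ∀ i : Fin M, MemLp (fun x : Fin M → X => f (x i)) 2 (Measure.pi fun _ => ν) :=
    fun i => hf.comp_measurePreserving (heval i)
  have hsum : MemLp (∑ i, fun x : Fin M → X => f (x i)) 2 (Measure.pi fun _ => ν) :=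
    memLp_finsetSum' _ fun i _ => hLp i
  have hfint : Integrable f ν := hf.integrable one_le_two
  have hmean : ∫ x, (∑ i, fun x : Fin M → X => f (x i)) x ∂(Measure.pi fun _ => ν) =
      M * ∫ x, f x ∂ν := by
    simp only [Finset.sum_apply]
    rw [integral_finsetSum _ fun i _ => (hLp i).integrable one_le_two]
    have : ∀ i : Fin M, ∫ x : Fin M → X, f (x i) ∂(Measure.pi fun _ => ν) = ∫ x, f x ∂ν :=
      fun i => integral_comp_eval (μ := fun _ : Fin M => ν) hf.1
    simp [this]
  have hvar : variance f ν ≤ m := by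
    rw [variance_eq_sub hf]
    simp only [Pi.pow_apply]
    linarith [sq_nonneg (∫ x, f x ∂ν)]
  have hcheb := meas_ge_le_variance_div_sq hsum (c := u * √M) (by positivity)
  rw [variance_sum_pi (X := fun _ => f) fun _ => hf, hmean] at hcheb
  simp only [Finset.sum_const, Finset.card_univ, Fintype.card_fin, nsmul_eq_mul,
    Finset.sum_apply] at hcheb
  have hle : M * variance f ν / (u * √M) ^ 2 ≤ m / u ^ 2 := by
    rw [mul_pow, Real.sq_sqrt hMpos.le, mul_comm, mul_div_mul_right _ _ hMpos.ne']
    gcongr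
  have hm0 : 0 ≤ m / u ^ 2 := by
    have := (variance_nonneg f ν).trans hvar
    positivity
  rw [measureReal_def]
  refine ENNReal.toReal_le_of_le_ofReal hm0 ((measure_mono fun x hx => ?_).trans
    (hcheb.trans (ENNReal.ofReal_le_ofReal hle)))
  have hx' : u / √M ≤ |(∑ j, f (x j)) / M - ∫ x, f x ∂ν| := hx
  have h1 : (∑ j, f (x j)) - M * ∫ x, f x ∂ν = ((∑ j, f (x j)) / M - ∫ x, f x ∂ν) * M := by
    field_simp
  show u * √M ≤ |(∑ j, f (x j)) - M * ∫ x, f x ∂ν|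
  rw [h1, abs_mul, abs_of_pos hMpos]
  rw [div_le_iff₀ hsM] at hx'
  have := mul_le_mul_of_nonneg_right hx' hsM.le
  rwa [mul_assoc _ √(M : ℝ), Real.mul_self_sqrt hMpos.le] at this

/-! ### Nested sampling: measurability and exceptional parameters. -/

instance iidKernel_isMarkovKernel {Θ Ξ : Type*} [MeasurableSpace Θ] [MeasurableSpace Ξ]
    (P : Kernel Θ Ξ) [IsMarkovKernel P] (M : ℕ) : IsMarkovKernel (BCR.iidKernel P M) :=
  ⟨fun θ => inferInstanceAs (IsProbabilityMeasure (Measure.pi fun _ : Fin M => P θ))⟩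

lemma measurable_expectedCost {E Θ Ξ : Type*} [MeasurableSpace Θ] [MeasurableSpace Ξ]
    {F : E → Ξ → ℝ} {P : Kernel Θ Ξ} [IsMarkovKernel P] {a : E} (hF : Measurable (F a)) :
    Measurable (BCR.expectedCost F P a) :=
  (hF.stronglyMeasurable.integral_kernel (κ := P)).measurable

lemma measurable_sampleMean {E Ξ : Type*} [MeasurableSpace Ξ] {F : E → Ξ → ℝ} {M : ℕ} {a : E}
    (hF : Measurable (F a)) : Measurable fun x : Fin M → Ξ => BCR.sampleMean F x a :=
  (Finset.measurable_sum _ fun j _ => hF.comp (measurable_pi_apply j)).div_const _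

/-- Outside a set of parameters of small prior mass, a moment generating function near `0` and a
second moment are bounded by one constant. -/
lemma exists_measurableSet_uniform_moments {Θ Ξ : Type*} [MeasurableSpace Θ] [MeasurableSpace Ξ]
    (P : Kernel Θ Ξ) [IsMarkovKernel P] (Q : Measure Θ) [IsProbabilityMeasure Q] {φ f : Ξ → ℝ}
    (hφ : Measurable φ) (hφ0 : ∀ ξ, 0 ≤ φ ξ)
    (hmgf : ∀ θ, (0 : ℝ) ∈ interior (integrableExpSet φ (P θ)))
    (hf : Measurable f) (hf2 : ∀ θ, MemLp f 2 (P θ)) {p : ℝ} (hp : 0 < p) :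
    ∃ m > (0 : ℝ), ∃ Θ₀ : Set Θ, MeasurableSet Θ₀ ∧ Q Θ₀ᶜ ≤ ENNReal.ofReal p ∧
      ∀ θ ∈ Θ₀, Integrable (fun ξ => Real.exp (φ ξ / m)) (P θ) ∧
        ∫ ξ, Real.exp (φ ξ / m) ∂(P θ) ≤ m ∧ ∫ ξ, f ξ ^ 2 ∂(P θ) ≤ m := by
  -- These sets increase to all of `Θ` because each `θ` has some exponential moment, so `Q (S k)ᶜ`
  -- tends to `0`. Lower integrals make them measurable and later supply integrability.
  set S : ℕ → Set Θ := fun k =>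
    {θ | ∫⁻ ξ, ENNReal.ofReal (Real.exp (φ ξ / (k + 1))) ∂(P θ) ≤ ENNReal.ofReal (k + 1)} ∩
    {θ | ∫⁻ ξ, ENNReal.ofReal (f ξ ^ 2) ∂(P θ) ≤ ENNReal.ofReal (k + 1)} with hS
  have hSm : ∀ k, MeasurableSet (S k) := fun k =>
    (measurableSet_le (Measurable.lintegral_kernel (by fun_prop)) measurable_const).inter
      (measurableSet_le (Measurable.lintegral_kernel (by fun_prop)) measurable_const)
  have hmono : Monotone S := by
    intro k l hkl θ hθ
    have hkl' : (k : ℝ) + 1 ≤ l + 1 := by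
      have : (k : ℝ) ≤ l := by exact_mod_cast hkl
      linarith
    refine ⟨le_trans (lintegral_mono fun ξ => ENNReal.ofReal_le_ofReal (Real.exp_le_exp.2 ?_))
      (hθ.1.trans (ENNReal.ofReal_le_ofReal hkl')),
      hθ.2.trans (ENNReal.ofReal_le_ofReal hkl')⟩
    exact div_le_div_of_nonneg_left (hφ0 ξ) (by positivity) hkl'
  have hunion : ⋃ k, S k = Set.univ := by
    refine Set.eq_univ_of_forall fun θ => Set.mem_iUnion.2 ?_
    obtain ⟨e, he, hball⟩ := Metric.mem_nhds_iff.1 (mem_interior_iff_mem_nhds.1 (hmgf θ))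
    have hmem : e / 2 ∈ integrableExpSet φ (P θ) := hball (by
      rw [Metric.mem_ball, Real.dist_eq, sub_zero, abs_of_pos (by positivity)]
      linarith)
    have hint : Integrable (fun ξ => Real.exp (e / 2 * φ ξ)) (P θ) := hmem
    obtain ⟨k, hk⟩ := exists_nat_ge
      (max (2 / e) (max (∫ ξ, Real.exp (e / 2 * φ ξ) ∂(P θ)) (∫ ξ, f ξ ^ 2 ∂(P θ))))
    have hk1 := (le_max_left _ _).trans hk
    have hk2 := ((le_max_left _ _).trans (le_max_right _ _)).trans hk
    have hk3 := ((le_max_right _ _).trans (le_max_right _ _)).trans hk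
    refine ⟨k, ?_, ?_⟩
    · have hle : ∀ ξ, Real.exp (φ ξ / (k + 1)) ≤ Real.exp (e / 2 * φ ξ) := by
        intro ξ
        refine Real.exp_le_exp.2 ?_
        rw [div_eq_inv_mul]
        refine mul_le_mul_of_nonneg_right ?_ (hφ0 ξ)
        rw [inv_le_comm₀ (by positivity) (by positivity), inv_div]
        linarith
      rw [Set.mem_ofPred_eq]
      refine (lintegral_mono fun ξ => ENNReal.ofReal_le_ofReal (hle ξ)).trans ?_
      rw [← ofReal_integral_eq_lintegral_ofReal hint (ae_of_all _ fun ξ => (Real.exp_pos _).le)]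
      exact ENNReal.ofReal_le_ofReal (by linarith)
    · rw [Set.mem_ofPred_eq]
      rw [← ofReal_integral_eq_lintegral_ofReal (hf2 θ).integrable_sq
        (ae_of_all _ fun ξ => sq_nonneg _)]
      exact ENNReal.ofReal_le_ofReal (by linarith)
  have hlim := tendsto_measure_iInter_atTop (μ := Q) (s := fun k => (S k)ᶜ)
    (fun k => (hSm k).compl.nullMeasurableSet)
    (fun k l hkl => Set.compl_subset_compl.2 (hmono hkl)) ⟨0, measure_ne_top _ _⟩
  rw [← Set.compl_iUnion, hunion, Set.compl_univ, measure_empty] at hlim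
  obtain ⟨k, hk⟩ := (hlim.eventually_lt_const (ENNReal.ofReal_pos.2 hp)).exists
  refine ⟨k + 1, by positivity, S k, hSm k, hk.le, fun θ hθ => ?_⟩
  have hexpm : Measurable fun ξ => Real.exp (φ ξ / ((k : ℝ) + 1)) := by fun_prop
  have hint : Integrable (fun ξ => Real.exp (φ ξ / ((k : ℝ) + 1))) (P θ) := by
    refine ⟨hexpm.aestronglyMeasurable, ?_⟩
    rw [hasFiniteIntegral_iff_ofReal (ae_of_all _ fun ξ => (Real.exp_pos _).le)]
    exact lt_of_le_of_lt hθ.1 ENNReal.ofReal_lt_top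
  refine ⟨hint, ?_, ?_⟩
  · rw [← ENNReal.ofReal_le_ofReal_iff (by positivity),
      ofReal_integral_eq_lintegral_ofReal hint (ae_of_all _ fun ξ => (Real.exp_pos _).le)]
    exact hθ.1
  · rw [← ENNReal.ofReal_le_ofReal_iff (by positivity),
      ofReal_integral_eq_lintegral_ofReal (hf2 θ).integrable_sq
        (ae_of_all _ fun ξ => sq_nonneg _)]
    exact hθ.2

/-- A bound on the conditional probability off an exceptional set of parameters bounds the joint
probability. -/
lemma compProd_union_le {Θ X : Type*} [MeasurableSpace Θ] [MeasurableSpace X] (Q : Measure Θ)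
    [IsProbabilityMeasure Q] (κ : Kernel Θ X) [IsMarkovKernel κ] {Θ₀ : Set Θ}
    (hΘ₀ : MeasurableSet Θ₀) {W : Set (Θ × X)} (hW : MeasurableSet W) {p : ENNReal}
    (hp : ∀ θ ∈ Θ₀, κ θ (Prod.mk θ ⁻¹' W) ≤ p) :
    (Q ⊗ₘ κ) (Prod.fst ⁻¹' Θ₀ᶜ ∪ W) ≤ Q Θ₀ᶜ + p := by
  rw [Measure.compProd_apply ((measurable_fst hΘ₀.compl).union hW)]
  calc ∫⁻ θ, κ θ (Prod.mk θ ⁻¹' (Prod.fst ⁻¹' Θ₀ᶜ ∪ W)) ∂Q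
      ≤ ∫⁻ θ, (Θ₀ᶜ.indicator 1 θ + p) ∂Q := by
        refine lintegral_mono fun θ => ?_
        by_cases hθ : θ ∈ Θ₀
        · have : Prod.mk θ ⁻¹' (Prod.fst ⁻¹' Θ₀ᶜ ∪ W) = Prod.mk θ ⁻¹' W := by
            ext x
            simp [hθ]
          rw [this]
          exact (hp θ hθ).trans le_add_self
        · refine prob_le_one.trans ?_
          simp [hθ]
    _ = Q Θ₀ᶜ + p := by
        rw [lintegral_add_right _ measurable_const, lintegral_indicator_one hΘ₀.compl]
        simp

/-! ### Chaining and the uniform law of large numbers. -/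

/-- Nets of a subset of a ball at dyadic scales, starting from a single point. -/
lemma exists_dyadic_nets {n : ℕ} {R : ℝ} (hR : 0 < R) (A : Set (EuclideanSpace ℝ (Fin n)))
    (hA : ∀ a ∈ A, ‖a‖ ≤ R) {a₀ : EuclideanSpace ℝ (Fin n)} (ha₀ : a₀ ∈ A) :
    ∃ T : ℕ → Finset (EuclideanSpace ℝ (Fin n)), T 0 = {a₀} ∧ (∀ j, ∀ b ∈ T j, b ∈ A) ∧
      (∀ j, ∀ a ∈ A, ∃ b ∈ T j, ‖a - b‖ ≤ 2 * R / 2 ^ j) ∧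
      ∀ j, ((T j).card : ℝ) ≤ (2 ^ (j + 1)) ^ n := by
  have hex : ∀ j : ℕ, ∃ T : Finset (EuclideanSpace ℝ (Fin n)), (j = 0 → T = {a₀}) ∧
      (∀ b ∈ T, b ∈ A) ∧ (∀ a ∈ A, ∃ b ∈ T, ‖a - b‖ ≤ 2 * R / 2 ^ j) ∧
      (T.card : ℝ) ≤ (2 ^ (j + 1)) ^ n := by
    intro j
    rcases Nat.eq_zero_or_pos j with rfl | hj
    · refine ⟨{a₀}, fun _ => rfl, by simpa using ha₀, fun a ha => ⟨a₀, by simp, ?_⟩, ?_⟩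
      · have := norm_sub_le a a₀
        simp only [pow_zero, div_one]
        linarith [hA a ha, hA a₀ ha₀]
      · simpa using one_le_pow₀ (one_le_two (α := ℝ))
    · obtain ⟨T, hTA, hnet, hcard⟩ := exists_finset_net hR.le
        (by positivity : 0 < 2 * R / 2 ^ j) A hA
      refine ⟨T, fun h => absurd h hj.ne', hTA, fun a ha => ?_, hcard.trans ?_⟩
      · simpa only [dist_eq_norm] using hnet a ha
      · refine pow_le_pow_left₀ (by positivity) ?_ n
        have h1 : 2 * R / (2 * R / 2 ^ j) = 2 ^ j := by field_simp
        rw [h1, pow_succ]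
        linarith [one_le_pow₀ (one_le_two (α := ℝ)) (n := j)]
  choose T hT0 hTA hnet hcard using hex
  exact ⟨T, hT0 0 rfl, hTA, hnet, hcard⟩

/-- Chaining: a function that is Lipschitz on `A` and whose increments along dyadic nets are
bounded by a summable sequence is bounded on `A` by the sum. -/
lemma abs_le_of_chaining {E : Type*} [SeminormedAddCommGroup E] {A : Set E} {a₀ : E}
    {T : ℕ → Finset E} (hT0 : T 0 = {a₀}) (hTA : ∀ j, ∀ b ∈ T j, b ∈ A) {R : ℝ}
    (hnet : ∀ j, ∀ a ∈ A, ∃ b ∈ T j, ‖a - b‖ ≤ R / 2 ^ j) {π : ℕ → E → E}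
    (hπ : ∀ j, ∀ a ∈ A, π j a ∈ T j) {Z : E → ℝ} {K : ℝ} (hK : 0 ≤ K)
    (hZ : ∀ a ∈ A, ∀ b ∈ A, |Z a - Z b| ≤ K * ‖a - b‖) {u c : ℝ} {w : ℕ → ℝ} (hc : 0 ≤ c)
    (hw : Summable w) (hw0 : ∀ j, 0 ≤ w j) (h0 : |Z a₀| ≤ u * c)
    (hinc : ∀ j, ∀ b ∈ T (j + 1), |Z b - Z (π j b)| ≤ w j * c) :
    ∀ a ∈ A, |Z a| ≤ (u + ∑' j, w j) * c := by
  have hchain : ∀ J, ∀ b ∈ T J, |Z b| ≤ (u + ∑ j ∈ Finset.range J, w j) * c := by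
    intro J
    induction J with
    | zero =>
      intro b hb
      rw [hT0, Finset.mem_singleton] at hb
      simpa [hb] using h0
    | succ J ih =>
      intro b hb
      have h1 := ih _ (hπ J b (hTA _ b hb))
      have h2 := hinc J b hb
      have h3 : |Z b| ≤ |Z b - Z (π J b)| + |Z (π J b)| := by
        simpa using abs_add_le (Z b - Z (π J b)) (Z (π J b))
      rw [Finset.sum_range_succ]
      linarith
  intro a ha
  -- The Lipschitz constant `K` enters only through a remainder vanishing as `J → ∞`. It may
  -- therefore depend on the sample with no quantitative control.
  have hbound : ∀ J : ℕ, |Z a| ≤ (u + ∑' j, w j) * c + K * (R / 2 ^ J) := by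
    intro J
    obtain ⟨b, hb, hab⟩ := hnet J a ha
    have h1 := hchain J b hb
    have h2 : (u + ∑ j ∈ Finset.range J, w j) * c ≤ (u + ∑' j, w j) * c := by
      gcongr
      exact hw.sum_le_tsum _ fun j _ => hw0 j
    have h3 := (hZ a ha b (hTA J b hb)).trans (mul_le_mul_of_nonneg_left hab hK)
    have h4 : |Z a| ≤ |Z a - Z b| + |Z b| := by
      simpa using abs_add_le (Z a - Z b) (Z b)
    linarith
  have hlim : Filter.Tendsto (fun J : ℕ => (u + ∑' j, w j) * c + K * (R / 2 ^ J)) Filter.atTop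
      (nhds ((u + ∑' j, w j) * c + K * 0)) := by
    refine tendsto_const_nhds.add (Filter.Tendsto.const_mul K ?_)
    exact tendsto_const_nhds.div_atTop (tendsto_pow_atTop_atTop_of_one_lt one_lt_two)
  have := ge_of_tendsto' hlim hbound
  simpa using this

lemma abs_sampleMean_sub_le {E Ξ : Type*} [SeminormedAddCommGroup E] {A : Set E} {F : E → Ξ → ℝ}
    {φ : Ξ → ℝ} (hφ : ∀ ξ, ∀ a ∈ A, ∀ b ∈ A, |F a ξ - F b ξ| ≤ φ ξ * ‖a - b‖) {M : ℕ}
    (x : Fin M → Ξ) {a b : E} (ha : a ∈ A) (hb : b ∈ A) :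
    |BCR.sampleMean F x a - BCR.sampleMean F x b| ≤ (∑ j, φ (x j)) / M * ‖a - b‖ := by
  rw [BCR.sampleMean, BCR.sampleMean, ← sub_div, ← Finset.sum_sub_distrib, abs_div,
    Nat.abs_cast, div_mul_eq_mul_div, Finset.sum_mul]
  gcongr
  exact (Finset.abs_sum_le_sum_abs _ _).trans (Finset.sum_le_sum fun j _ => hφ _ a ha b hb)

lemma summable_affine_mul_geometric (x y : ℝ) :
    Summable fun j : ℕ => (x * j + y) * (1 / 2 : ℝ) ^ j := by
  have h1 : Summable fun j : ℕ => (j : ℝ) ^ 1 * (1 / 2 : ℝ) ^ j :=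
    summable_pow_mul_geometric_of_norm_lt_one 1 (by norm_num)
  have h2 : Summable fun j : ℕ => (1 / 2 : ℝ) ^ j := summable_geometric_two
  refine ((h1.mul_left x).add (h2.mul_left y)).congr fun j => ?_
  ring

lemma tsum_ofReal_mul_geometric {q : ℝ} (hq : 0 ≤ q) :
    ∑' j : ℕ, ENNReal.ofReal (q * (1 / 2) ^ (j + 1)) = ENNReal.ofReal q := by
  have hs : HasSum (fun j : ℕ => q * (1 / 2 : ℝ) ^ (j + 1)) q := by
    have := (hasSum_geometric_two).mul_left (q / 2)
    convert! this using 1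
    · funext j
      rw [pow_succ]
      ring
    · ring
  rw [← ENNReal.ofReal_tsum_of_nonneg (fun j => by positivity) hs.summable, hs.tsum_eq]

/-- Uniform law of large numbers at rate `1/√M` over a bounded set of actions: outside an event of
the joint law of `(θ, x)` of probability at most `p`, all sample means are within `B/√M` of their
conditional expectations, where `B` does not depend on `M`. -/
theorem exists_uniform_deviation_bound {Θ Ξ : Type*} [MeasurableSpace Θ] [MeasurableSpace Ξ]
    {n : ℕ} (P : Kernel Θ Ξ) [IsMarkovKernel P] (Q : Measure Θ) [IsProbabilityMeasure Q]
    {A : Set (EuclideanSpace ℝ (Fin n))} (hA : A.Nonempty) {R : ℝ} (hR : ∀ a ∈ A, ‖a‖ ≤ R)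
    {F : EuclideanSpace ℝ (Fin n) → Ξ → ℝ} (hmeas : ∀ a ∈ A, Measurable (F a))
    (hsq : ∀ a ∈ A, ∀ θ, MemLp (F a) 2 (P θ)) {L : ℝ} (hL : 0 ≤ L)
    (hLip : ∀ θ, ∀ a₁ ∈ A, ∀ a₂ ∈ A,
      |BCR.expectedCost F P a₁ θ - BCR.expectedCost F P a₂ θ| ≤ L * ‖a₁ - a₂‖)
    {φ : Ξ → ℝ} (hφ : Measurable φ) (hφ0 : ∀ ξ, 0 ≤ φ ξ)
    (hφLip : ∀ ξ, ∀ a₁ ∈ A, ∀ a₂ ∈ A, |F a₁ ξ - F a₂ ξ| ≤ φ ξ * ‖a₁ - a₂‖)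
    (hmgf : ∀ θ, (0 : ℝ) ∈ interior (integrableExpSet φ (P θ))) {p : ℝ} (hp : 0 < p) :
    ∃ B > (0 : ℝ), ∀ M : ℕ, 0 < M → ∃ W : Set (Θ × (Fin M → Ξ)), MeasurableSet W ∧
      (Q ⊗ₘ BCR.iidKernel P M) W ≤ ENNReal.ofReal p ∧
      ∀ ω ∉ W, ∀ a ∈ A, |BCR.sampleMean F ω.2 a - BCR.expectedCost F P a ω.1| ≤ B / √M := by
  classical
  obtain ⟨a₀, ha₀⟩ := hA
  have hR1 : 0 < max R 1 := by positivity
  -- Half of `p` pays for the exceptional parameters. The second moment is needed at the base point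
  -- alone, since increments are dominated by `φ`.
  obtain ⟨m, hm, Θ₀, hΘ₀, hQ, hmom⟩ := exists_measurableSet_uniform_moments P Q hφ hφ0 hmgf
    (hmeas a₀ ha₀) (hsq a₀ ha₀) (half_pos hp)
  obtain ⟨T, hT0, hTA, hnet, hcard⟩ := exists_dyadic_nets hR1 A
    (fun a ha => (hR a ha).trans (le_max_left _ _)) ha₀
  have hproj : ∀ (j : ℕ) (a : EuclideanSpace ℝ (Fin n)), ∃ b, a ∈ A →
      b ∈ T j ∧ ‖a - b‖ ≤ 2 * max R 1 / 2 ^ j := by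
    intro j a
    by_cases ha : a ∈ A
    · obtain ⟨b, hb, hab⟩ := hnet j a ha
      exact ⟨b, fun _ => ⟨hb, hab⟩⟩
    · exact ⟨a, fun h => absurd h ha⟩
  choose π hπ using hproj
  set K : ℝ := 2 * (m * Real.exp m)
  -- Chosen so that `2 * exp (K - c) ≤ p / 4`; the absolute value keeps the chaining weights
  -- nonnegative.
  set c : ℝ := |K - Real.log (p / 8)|
  have hc : 2 * Real.exp (K - c) ≤ p / 4 := by
    have h1 : K - c ≤ Real.log (p / 8) := by linarith [le_abs_self (K - Real.log (p / 8))]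
    have h2 := Real.exp_le_exp.2 h1
    rw [Real.exp_log (by positivity)] at h2
    linarith
  have hc0 : 0 ≤ c := abs_nonneg _
  -- In the tail exponent, `n(j + 2)` beats the cardinality of the net at level `j + 1`, `j + 1`
  -- gives geometric decay, and `c` fixes the total at `p / 4`. As `v` is affine and `r` geometric,
  -- `w` is summable.
  set v : ℕ → ℝ := fun j => n * ((j : ℝ) + 2) + (j + 1) + c with hv
  have hv0 : ∀ j, 0 ≤ v j := fun j => by positivity
  set r : ℕ → ℝ := fun j => 2 * max R 1 / 2 ^ j with hr
  have hr0 : ∀ j, 0 < r j := fun j => by positivity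
  set w : ℕ → ℝ := fun j => v j * (2 * m * r j) with hw
  have hw0 : ∀ j, 0 ≤ w j := fun j =>
    mul_nonneg (hv0 j) (mul_nonneg (by positivity) (hr0 j).le)
  have hwsum : Summable w := by
    refine ((summable_affine_mul_geometric (n + 1) (2 * n + 1 + c)).mul_left
      (2 * m * (2 * max R 1))).congr fun j => ?_
    rw [show (1 / 2 : ℝ) ^ j = (2 ^ j)⁻¹ by rw [one_div, inv_pow]]
    simp only [hw, hv, hr, div_eq_mul_inv]
    ring
  -- Chebyshev's inequality at the base point then costs `p / 4`.
  set u : ℝ := √(4 * m / p) with hu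
  have hu0 : 0 < u := Real.sqrt_pos.2 (by positivity)
  have husq : m / u ^ 2 = p / 4 := by
    rw [hu, Real.sq_sqrt (by positivity)]
    field_simp
  have htail : ∀ j, ((T (j + 1)).card : ℝ) * (2 * Real.exp (K - v j)) ≤
      p / 4 * (1 / 2) ^ (j + 1) := by
    intro j
    have h2exp : ∀ k : ℕ, (2 : ℝ) ^ k ≤ Real.exp k := by
      intro k
      rw [← mul_one (k : ℝ), Real.exp_nat_mul]
      exact pow_le_pow_left₀ zero_le_two (by linarith [Real.add_one_le_exp (1 : ℝ)]) k
    have h1 : ((T (j + 1)).card : ℝ) ≤ Real.exp (n * ((j : ℝ) + 2)) := by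
      refine (hcard (j + 1)).trans ?_
      rw [Real.exp_nat_mul]
      refine pow_le_pow_left₀ (by positivity) ?_ n
      have := h2exp (j + 1 + 1)
      push_cast at this
      rwa [show (j : ℝ) + 1 + 1 = j + 2 by ring] at this
    have h2 : Real.exp (-((j : ℝ) + 1)) ≤ (1 / 2) ^ (j + 1) := by
      rw [Real.exp_neg, one_div, inv_pow]
      have := h2exp (j + 1)
      push_cast at this
      exact inv_anti₀ (by positivity) this
    have h3 : Real.exp (K - v j) =
        Real.exp (-(n * ((j : ℝ) + 2))) * Real.exp (-((j : ℝ) + 1)) * Real.exp (K - c) := by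
      rw [← Real.exp_add, ← Real.exp_add, hv]
      congr 1
      ring
    calc ((T (j + 1)).card : ℝ) * (2 * Real.exp (K - v j))
        ≤ Real.exp (n * ((j : ℝ) + 2)) * (2 * Real.exp (K - v j)) := by gcongr
      _ = Real.exp (-((j : ℝ) + 1)) * (2 * Real.exp (K - c)) := by
        rw [h3, Real.exp_neg (n * ((j : ℝ) + 2))]
        field_simp
      _ ≤ (1 / 2) ^ (j + 1) * (p / 4) := by gcongr
      _ = _ := by ring
  refine ⟨u + ∑' j, w j, add_pos_of_pos_of_nonneg hu0 (tsum_nonneg hw0), fun M hM => ?_⟩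
  have hMpos : (0 : ℝ) < M := by exact_mod_cast hM
  set Z : EuclideanSpace ℝ (Fin n) → Θ × (Fin M → Ξ) → ℝ := fun a ω =>
    BCR.sampleMean F ω.2 a - BCR.expectedCost F P a ω.1 with hZ
  have hZm : ∀ a ∈ A, Measurable (Z a) := fun a ha =>
    ((measurable_sampleMean (hmeas a ha)).comp measurable_snd).sub
      ((measurable_expectedCost (hmeas a ha)).comp measurable_fst)
  set W₀ : Set (Θ × (Fin M → Ξ)) := {ω | u / √M ≤ |Z a₀ ω|} with hW₀
  set W₁ : ℕ → EuclideanSpace ℝ (Fin n) → Set (Θ × (Fin M → Ξ)) := fun j b =>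
    {ω | w j / √M ≤ |Z b ω - Z (π j b) ω|} with hW₁
  set W : Set (Θ × (Fin M → Ξ)) := W₀ ∪ ⋃ j, ⋃ b ∈ T (j + 1), W₁ j b with hW
  have hWm : MeasurableSet W := by
    refine (measurableSet_le measurable_const (hZm a₀ ha₀).abs).union
      (MeasurableSet.iUnion fun j => Finset.measurableSet_biUnion _ fun b hb => ?_)
    have hbA := hTA _ b hb
    exact measurableSet_le measurable_const
      ((hZm b hbA).sub (hZm _ (hTA j _ (hπ j b hbA).1))).abs
  have hsec : ∀ θ ∈ Θ₀, BCR.iidKernel P M θ (Prod.mk θ ⁻¹' W) ≤ ENNReal.ofReal (p / 2) := by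
    intro θ hθ
    obtain ⟨hint, hle, hvar⟩ := hmom θ hθ
    set ν : Measure (Fin M → Ξ) := Measure.pi fun _ : Fin M => P θ with hν
    have h0 : ν (Prod.mk θ ⁻¹' W₀) ≤ ENNReal.ofReal (p / 4) := by
      have := measureReal_pi_sampleMean_dev_le_div_sq (P θ) (hsq a₀ ha₀ θ) hvar hM hu0
      rw [husq] at this
      exact (ENNReal.le_ofReal_iff_toReal_le (measure_ne_top _ _) (by positivity)).2 this
    have h1 : ∀ j, ∀ b ∈ T (j + 1), ν (Prod.mk θ ⁻¹' W₁ j b) ≤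
        ENNReal.ofReal (2 * Real.exp (K - v j)) := by
      intro j b hb
      have hbA := hTA _ b hb
      have hπA := hTA j _ (hπ j b hbA).1
      have hdev := measureReal_pi_sampleMean_dev_le (P θ) hφ hφ0 hm hint hle
        (f := fun ξ => F b ξ - F (π j b) ξ) ((hmeas b hbA).sub (hmeas _ hπA)) (hr0 j)
        (fun ξ => (hφLip ξ b hbA _ hπA).trans
          (mul_le_mul_of_nonneg_left (hπ j b hbA).2 (hφ0 ξ))) hM (v j)
      refine (ENNReal.le_ofReal_iff_toReal_le (measure_ne_top _ _) (by positivity)).2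
        (le_trans (measureReal_mono fun x hx => ?_) hdev)
      have hx' : w j / √M ≤ |Z b (θ, x) - Z (π j b) (θ, x)| := hx
      have heq : (∑ i, (F b (x i) - F (π j b) (x i))) / M -
          ∫ ξ, (F b ξ - F (π j b) ξ) ∂(P θ) = Z b (θ, x) - Z (π j b) (θ, x) := by
        rw [integral_sub ((hsq b hbA θ).integrable one_le_two)
          ((hsq _ hπA θ).integrable one_le_two), Finset.sum_sub_distrib, sub_div]
        simp only [hZ, BCR.sampleMean, BCR.expectedCost]
        ring
      show v j * (2 * m * r j) / √M ≤ |_|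
      rw [heq]
      exact hx'
    have h2 : ∀ j, ν (⋃ b ∈ T (j + 1), Prod.mk θ ⁻¹' W₁ j b) ≤
        ENNReal.ofReal (p / 4 * (1 / 2) ^ (j + 1)) := by
      intro j
      refine (measure_biUnion_finset_le _ _).trans ((Finset.sum_le_sum (h1 j)).trans ?_)
      rw [Finset.sum_const, nsmul_eq_mul, ← ENNReal.ofReal_natCast,
        ← ENNReal.ofReal_mul (Nat.cast_nonneg _)]
      exact ENNReal.ofReal_le_ofReal (htail j)
    show ν _ ≤ _
    rw [hW]
    simp only [Set.preimage_union, Set.preimage_iUnion]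
    calc _ ≤ ν (Prod.mk θ ⁻¹' W₀) + ν (⋃ j, ⋃ b ∈ T (j + 1), Prod.mk θ ⁻¹' W₁ j b) :=
          measure_union_le _ _
      _ ≤ ENNReal.ofReal (p / 4) + ∑' j, ENNReal.ofReal (p / 4 * (1 / 2) ^ (j + 1)) :=
          add_le_add h0 ((measure_iUnion_le _).trans (ENNReal.tsum_le_tsum h2))
      _ = ENNReal.ofReal (p / 2) := by
        rw [tsum_ofReal_mul_geometric (by positivity), ← ENNReal.ofReal_add (by positivity)
          (by positivity)]
        congr 1
        ring
  refine ⟨Prod.fst ⁻¹' Θ₀ᶜ ∪ W, (measurable_fst hΘ₀.compl).union hWm, ?_, ?_⟩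
  · refine (compProd_union_le Q _ hΘ₀ hWm hsec).trans ((add_le_add_left hQ _).trans ?_)
    rw [← ENNReal.ofReal_add (by positivity) (by positivity), add_halves]
  · intro ω hω
    have hωW : ω ∉ W := fun h => hω (Or.inr h)
    have h0 : |Z a₀ ω| ≤ u * (√M)⁻¹ := by
      rw [← div_eq_mul_inv]
      by_contra! h
      exact hωW (Or.inl h.le)
    have hinc : ∀ j, ∀ b ∈ T (j + 1), |Z b ω - Z (π j b) ω| ≤ w j * (√M)⁻¹ := by
      intro j b hb
      rw [← div_eq_mul_inv]
      by_contra! h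
      exact hωW (Or.inr (Set.mem_iUnion.2 ⟨j, Set.mem_iUnion₂.2 ⟨b, hb, h.le⟩⟩))
    have hLipZ : ∀ a ∈ A, ∀ b ∈ A, |Z a ω - Z b ω| ≤
        ((∑ j, φ (ω.2 j)) / M + L) * ‖a - b‖ := by
      intro a ha b hb
      have h1 := abs_sampleMean_sub_le hφLip ω.2 ha hb
      have h2 := hLip ω.1 a ha b hb
      have h3 := abs_sub (BCR.sampleMean F ω.2 a - BCR.sampleMean F ω.2 b)
        (BCR.expectedCost F P a ω.1 - BCR.expectedCost F P b ω.1)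
      have h4 : Z a ω - Z b ω = (BCR.sampleMean F ω.2 a - BCR.sampleMean F ω.2 b) -
        (BCR.expectedCost F P a ω.1 - BCR.expectedCost F P b ω.1) := by
        simp only [hZ]
        ring
      rw [h4, add_mul]
      linarith
    have hK0 : 0 ≤ (∑ j, φ (ω.2 j)) / M + L :=
      add_nonneg (div_nonneg (Finset.sum_nonneg fun j _ => hφ0 _) hMpos.le) hL
    simp only [div_eq_mul_inv (u + ∑' j, w j)]
    exact abs_le_of_chaining hT0 hTA hnet (fun j a ha => (hπ j a ha).1) hK0 hLipZ
      (by positivity) hwsum hw0 h0 hinc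

/-! ### The mixed-integer problem as counting, and quantiles. -/

/-- If at most a fraction `α < 1` of the sample means at `a` exceed `κ`, then `κ` is feasible for
the mixed-integer problem. -/
lemma saaValue_le {E Ξ : Type*} {N M : ℕ} {A : Set E} {F : E → Ξ → ℝ} {x : Fin N → Fin M → Ξ}
    {U α κ : ℝ} (hU : BCR.IsBigM A F x U) {a : E} (ha : a ∈ A) (hN : 0 < N) (hα : α < 1)
    (hcount : ∑ i, {y | κ < BCR.sampleMean F y a}.indicator (fun _ => (1 : ℝ)) (x i) ≤ α * N) :
    BCR.saaValue A F x U α ≤ κ := by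
  classical
  have hNpos : (0 : ℝ) < N := by exact_mod_cast hN
  set B : Finset (Fin N) := Finset.univ.filter fun i => κ < BCR.sampleMean F (x i) a with hB
  have hBcard : (B.card : ℝ) ≤ α * N := by
    refine le_trans (le_of_eq ?_) hcount
    rw [hB, Finset.card_filter]
    push_cast
    exact Finset.sum_congr rfl fun i _ => by
      by_cases h : κ < BCR.sampleMean F (x i) a <;> simp [h]
  have hk0 : 0 ≤ ⌊α * N⌋ := Int.floor_nonneg.2 ((Nat.cast_nonneg _).trans hBcard)
  have hBk : (B.card : ℤ) ≤ ⌊α * N⌋ := Int.le_floor.2 (by exact_mod_cast hBcard)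
  have hkN : ⌊α * N⌋ < (N : ℤ) := by
    rw [Int.floor_lt]
    push_cast
    nlinarith
  -- The constraint on `z` is an equality, so the exceeding indices are padded to exactly `⌊αN⌋` of
  -- them.
  obtain ⟨t, hBt, ht⟩ := Finset.exists_superset_card_eq (s := B) (n := ⌊α * N⌋.toNat)
    (by omega) (by rw [Fintype.card_fin]; omega)
  refine sInf_le ⟨κ, ⟨a, ha, fun i => if i ∈ t then 1 else 0, fun i => ?_, fun i => ?_, ?_⟩, rfl⟩
  · by_cases h : i ∈ t <;> simp [h]
  · by_cases h : i ∈ t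
    -- As `⌊αN⌋ < N`, some sample mean is at most `κ`; comparing with it shows that `U` relaxes row
    -- `i` far enough.
    · obtain ⟨i', hi'⟩ : ∃ i', i' ∉ B := by
        by_contra! hall
        have := Finset.card_eq_of_equiv_fin (Equiv.subtypeUnivEquiv (p := fun i => i ∈ B) hall)
        omega
      have hle : BCR.sampleMean F (x i') a ≤ κ := by
        simpa [hB] using hi'
      have := hU a ha a ha i i'
      simp only [h, if_true]
      linarith
    · have : i ∉ B := fun hi => h (hBt hi)
      have hle : BCR.sampleMean F (x i) a ≤ κ := by
        simpa [hB] using this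
      simpa [h] using hle
  · rw [Finset.sum_ite_mem, Finset.univ_inter, Finset.sum_const, ht, nsmul_eq_mul, mul_one,
      ← Int.cast_natCast, Int.toNat_of_nonneg hk0]

/-- At a feasible point of the mixed-integer problem, at most a fraction `α` of the sample means
exceed the objective value. -/
lemma sum_indicator_le_of_feasible {E Ξ : Type*} {N M : ℕ} {F : E → Ξ → ℝ}
    {x : Fin N → Fin M → Ξ} {U α κ : ℝ} {a : E} {z : Fin N → ℝ} (hz : ∀ i, z i = 0 ∨ z i = 1)
    (hκ : ∀ i, -U * z i + BCR.sampleMean F (x i) a ≤ κ) (hsum : ∑ i, z i = (⌊α * N⌋ : ℝ)) :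
    ∑ i, {y | κ < BCR.sampleMean F y a}.indicator (fun _ => (1 : ℝ)) (x i) ≤ α * N := by
  refine le_trans (Finset.sum_le_sum fun i _ => ?_) (hsum.le.trans (Int.floor_le _))
  rcases hz i with h | h
  · have := hκ i
    rw [h, mul_zero, zero_add] at this
    simp [h, this]
  · rw [h]
    exact Set.indicator_le_self' (fun _ _ => zero_le_one) _

/-- As `f` is real-valued, its superlevel sets exhaust `Θ`. This keeps quantiles away from `-∞`. -/
lemma exists_le_measure_superlevel {Θ : Type*} [MeasurableSpace Θ] (Q : Measure Θ)
    [IsProbabilityMeasure Q] (f : Θ → ℝ) {α : ℝ} (hα : α < 1) :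
    ∃ c : ℝ, ENNReal.ofReal α < Q {θ | c ≤ f θ} := by
  have hlim := tendsto_measure_iUnion_atTop (μ := Q) (s := fun k : ℕ => {θ | -(k : ℝ) ≤ f θ})
    (fun k l hkl θ (hθ : -(k : ℝ) ≤ f θ) =>
      show -(l : ℝ) ≤ f θ from (neg_le_neg (Nat.cast_le.2 hkl)).trans hθ)
  have huniv : ⋃ k : ℕ, {θ | -(k : ℝ) ≤ f θ} = Set.univ := by
    refine Set.eq_univ_of_forall fun θ => Set.mem_iUnion.2 ?_
    obtain ⟨k, hk⟩ := exists_nat_ge (-f θ)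
    exact ⟨k, neg_le.1 hk⟩
  rw [huniv, measure_univ] at hlim
  obtain ⟨k, hk⟩ := (hlim.eventually_const_lt (u := ENNReal.ofReal α)
    (by rwa [ENNReal.ofReal_lt_one])).exists
  exact ⟨_, hk⟩

/-- Continuity from above along superlevel sets with empty intersection; it keeps quantiles away
from `+∞`. -/
lemma exists_measure_superlevel_le {Θ : Type*} [MeasurableSpace Θ] (Q : Measure Θ)
    [IsProbabilityMeasure Q] {f : Θ → ℝ} (hf : Measurable f) {α : ℝ} (hα : 0 < α) :
    ∃ c : ℝ, Q {θ | c ≤ f θ} ≤ ENNReal.ofReal α := by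
  have hlim := tendsto_measure_iInter_atTop (μ := Q) (s := fun k : ℕ => {θ | (k : ℝ) ≤ f θ})
    (fun k => (measurableSet_le measurable_const hf).nullMeasurableSet)
    (fun k l hkl θ (hθ : (l : ℝ) ≤ f θ) =>
      show (k : ℝ) ≤ f θ from (Nat.cast_le.2 hkl).trans hθ) ⟨0, measure_ne_top _ _⟩
  have hempty : ⋂ k : ℕ, {θ | (k : ℝ) ≤ f θ} = ∅ := by
    refine Set.eq_empty_of_forall_notMem fun θ hθ => ?_
    obtain ⟨k, hk⟩ := exists_nat_gt (f θ)
    exact absurd (Set.mem_iInter.1 hθ k) (not_le.2 hk)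
  rw [hempty, measure_empty] at hlim
  obtain ⟨k, hk⟩ := (hlim.eventually_lt_const (ENNReal.ofReal_pos.2 hα)).exists
  exact ⟨_, hk.le⟩

/-- An approximate upper `α`-quantile. -/
lemma exists_near_quantile {Θ : Type*} [MeasurableSpace Θ] (Q : Measure Θ)
    [IsProbabilityMeasure Q] {f : Θ → ℝ} (hf : Measurable f) {α δ : ℝ} (hα0 : 0 < α)
    (hα1 : α < 1) (hδ : 0 < δ) :
    ∃ c : ℝ, ENNReal.ofReal α < Q {θ | c ≤ f θ} ∧
      ∀ κ : ℝ, ENNReal.ofReal α < Q {θ | κ ≤ f θ} → κ ≤ c + δ := by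
  obtain ⟨l, hl⟩ := exists_le_measure_superlevel Q f hα1
  obtain ⟨b, hb⟩ := exists_measure_superlevel_le Q hf hα0
  have hbdd : BddAbove {κ : ℝ | ENNReal.ofReal α < Q {θ | κ ≤ f θ}} := by
    refine ⟨b, fun κ hκ => ?_⟩
    by_contra! h
    exact absurd (lt_of_lt_of_le hκ (measure_mono fun θ hθ => h.le.trans hθ)) (not_lt.2 hb)
  -- The supremum itself may have superlevel mass exactly `α`, so a nearby member is taken.
  obtain ⟨c, hc, hlt⟩ := exists_lt_of_lt_csSup
    (s := {κ : ℝ | ENNReal.ofReal α < Q {θ | κ ≤ f θ}}) ⟨l, hl⟩ (sub_lt_self _ hδ)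
  exact ⟨c, hc, fun κ hκ => by linarith [le_csSup hbdd hκ]⟩

/-- A `δ`-optimal feasible point of the chance-constrained problem. -/
lemma exists_near_optimal {E Θ Ξ : Type*} [SeminormedAddCommGroup E] [MeasurableSpace Θ]
    [MeasurableSpace Ξ] (P : Kernel Θ Ξ) [IsMarkovKernel P] (Q : Measure Θ)
    [IsProbabilityMeasure Q] {A : Set E} (hA : A.Nonempty) {D : ℝ} (hD : ∀ a ∈ A, ‖a‖ ≤ D)
    {F : E → Ξ → ℝ} (hmeas : ∀ a ∈ A, Measurable (F a)) {L : ℝ} (hL : 0 ≤ L)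
    (hLip : ∀ θ, ∀ a₁ ∈ A, ∀ a₂ ∈ A,
      |BCR.expectedCost F P a₁ θ - BCR.expectedCost F P a₂ θ| ≤ L * ‖a₁ - a₂‖)
    {α δ : ℝ} (hα0 : 0 < α) (hα1 : α < 1) (hδ : 0 < δ) :
    ∃ κ : ℝ, ∃ a ∈ A, Q {θ | κ ≤ BCR.expectedCost F P a θ} ≤ ENNReal.ofReal α ∧
      ((κ - δ : ℝ) : EReal) ≤ BCR.trueValue A F P Q α := by
  obtain ⟨a₀, ha₀⟩ := hA
  obtain ⟨b, hb⟩ := exists_measure_superlevel_le Q (measurable_expectedCost (P := P)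
    (hmeas a₀ ha₀)) hα0
  obtain ⟨l, hl⟩ := exists_le_measure_superlevel Q (BCR.expectedCost F P a₀) hα1
  have hbdd : BddBelow
      {κ : ℝ | ∃ a ∈ A, Q {θ | κ ≤ BCR.expectedCost F P a θ} ≤ ENNReal.ofReal α} := by
    -- Moving from `a₀` to any `a ∈ A` changes the expected cost by at most `2LD`, so every lower
    -- level is infeasible for all actions.
    refine ⟨l - L * (2 * D), ?_⟩
    rintro κ ⟨a, ha, hκ⟩
    by_contra! h
    refine absurd (lt_of_lt_of_le hl (measure_mono fun θ hθ => ?_)) (not_lt.2 hκ)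
    have hθ' : l ≤ BCR.expectedCost F P a₀ θ := hθ
    have h1 := (abs_le.1 (hLip θ a ha a₀ ha₀)).1
    have h2 : L * ‖a - a₀‖ ≤ L * (2 * D) := by
      gcongr
      linarith [norm_sub_le a a₀, hD a ha, hD a₀ ha₀]
    show κ ≤ _
    linarith
  obtain ⟨κ, ⟨a, ha, hκ⟩, hlt⟩ := exists_lt_of_csInf_lt
    (s := {κ : ℝ | ∃ a ∈ A, Q {θ | κ ≤ BCR.expectedCost F P a θ} ≤ ENNReal.ofReal α})
    ⟨b, a₀, ha₀, hb⟩ (lt_add_of_pos_right _ hδ)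
  refine ⟨κ, a, ha, hκ, le_sInf ?_⟩
  rintro _ ⟨κ', hκ', rfl⟩
  rw [EReal.coe_le_coe_iff]
  linarith [csInf_le hbdd hκ']

/-! ### Sample-size arithmetic. -/

/-- The inner sample size makes the uniform deviation bound at most `δ / 2`. -/
lemma div_sqrt_le_half_of_innerSampleSize_le {n M : ℕ} {B D δ ε' : ℝ} (hB : 0 < B) (hD : 0 ≤ D)
    (hδ : 0 < δ) (hε0 : 0 < ε') (hε' : ε' < 1 / 2)
    (hM : BCR.innerSampleSize n B 1 D δ ε' ≤ M) : 0 < M ∧ B / √M ≤ δ / 2 := by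
  -- From `log (1 / ε') ≥ 1 - ε'`. This bound alone yields `M ≥ 4B² / δ²`.
  have hlog : 1 / 2 ≤ Real.log (1 / ε') := by
    have h1 := Real.one_sub_inv_le_log_of_pos (one_div_pos.2 hε0)
    rw [one_div, inv_inv] at h1
    rw [one_div ε']
    linarith
  have hlog2 : 0 ≤ Real.log (1 + D ^ n / 1 ^ n) :=
    Real.log_nonneg (le_add_of_nonneg_right (by positivity))
  have hle : 4 * B ^ 2 / δ ^ 2 ≤ M := by
    refine le_trans ?_ hM
    rw [BCR.innerSampleSize]
    calc 4 * B ^ 2 / δ ^ 2 = 8 * B ^ 2 / δ ^ 2 * (0 + 1 / 2) := by ring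
      _ ≤ _ := by gcongr
  have hMpos : (0 : ℝ) < M := lt_of_lt_of_le (by positivity) hle
  refine ⟨by exact_mod_cast hMpos, ?_⟩
  rw [div_le_iff₀ (Real.sqrt_pos.2 hMpos)]
  have h1 : 2 * B / δ ≤ √M := by
    refine Real.le_sqrt_of_sq_le (le_trans (le_of_eq ?_) hle)
    rw [div_pow]
    ring
  rw [div_le_iff₀ hδ] at h1
  linarith

/-- The outer sample size absorbs the union bound over a net of `K` points. -/
lemma mul_exp_le_of_outerSampleSize_le {n N : ℕ} {L D η ι ε K : ℝ} (hι : 0 < ι) (hε0 : 0 < ε)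
    (hε1 : ε < 1) (hK : 1 ≤ K)
    (hlog : Real.log K ≤ n * Real.log (⌈2 * L * D / η⌉ : ℝ) + n * Real.log (⌈2 / ι⌉ : ℝ))
    (hN : BCR.outerSampleSize n L D η ι ε ≤ N) :
    0 < N ∧ K * Real.exp (-2 * N * (ι / 2) ^ 2) ≤ ε := by
  have hKpos : 0 < K := by linarith
  have hle : 2 / ι ^ 2 * (Real.log (1 / ε) + Real.log K) ≤ N := by
    refine le_trans ?_ hN
    rw [BCR.outerSampleSize]
    exact mul_le_mul_of_nonneg_left (by linarith) (by positivity)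
  have hlogε : 0 < Real.log (1 / ε) := Real.log_pos (by rwa [lt_div_iff₀ hε0, one_mul])
  have hlogK : 0 ≤ Real.log K := Real.log_nonneg hK
  have hNpos : (0 : ℝ) < N := lt_of_lt_of_le (by positivity) hle
  refine ⟨by exact_mod_cast hNpos, ?_⟩
  rw [div_mul_eq_mul_div, div_le_iff₀ (by positivity)] at hle
  have hexp : -2 * N * (ι / 2) ^ 2 ≤ Real.log ε - Real.log K := by
    rw [one_div, Real.log_inv] at hle
    linarith
  have := Real.exp_le_exp.2 hexp
  rw [Real.exp_sub, Real.exp_log hε0, Real.exp_log hKpos, le_div_iff₀ hKpos] at this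
  linarith

lemma sum_indicator_add_sum_indicator_compl {X : Type*} (E : Set X) {N : ℕ} (ω : Fin N → X) :
    ∑ i, E.indicator (fun _ => (1 : ℝ)) (ω i) + ∑ i, Eᶜ.indicator (fun _ => (1 : ℝ)) (ω i) = N := by
  rw [← Finset.sum_add_distrib]
  simp [Set.indicator_self_add_compl_apply]

/-! ### The sandwich between neighbouring risk levels. -/

/-- The optimal value of the chance-constrained problem is sandwiched between those of the nested
sample average approximations at neighbouring risk levels. -/
theorem holdsWithProbAtLeast_saaValue {Θ Ξ : Type*} [MeasurableSpace Θ] [MeasurableSpace Ξ]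
    {n N M : ℕ} (P : Kernel Θ Ξ) [IsMarkovKernel P] (Q : Measure Θ) [IsProbabilityMeasure Q]
    {A : Set (EuclideanSpace ℝ (Fin n))} (hA : A.Nonempty) {D : ℝ} (hD : ∀ a ∈ A, ‖a‖ ≤ D)
    {F : EuclideanSpace ℝ (Fin n) → Ξ → ℝ} (hmeas : ∀ a ∈ A, Measurable (F a)) {L : ℝ}
    (hL : 0 ≤ L)
    (hLip : ∀ θ, ∀ a₁ ∈ A, ∀ a₂ ∈ A,
      |BCR.expectedCost F P a₁ θ - BCR.expectedCost F P a₂ θ| ≤ L * ‖a₁ - a₂‖)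
    {α ι ε η δ : ℝ} (hι : 0 < ι) (hα : ι < α) (hα1 : α + ι < 1) (hδ : 0 < δ) (hN : 0 < N)
    {W : Set (Θ × (Fin M → Ξ))} (hW : MeasurableSet W)
    (hWp : (Q ⊗ₘ BCR.iidKernel P M) W ≤ ENNReal.ofReal (ι / 2))
    (hdev : ∀ ω ∉ W, ∀ a ∈ A,
      |BCR.sampleMean F ω.2 a - BCR.expectedCost F P a ω.1| ≤ δ / 2)
    {T : Finset (EuclideanSpace ℝ (Fin n))} (hTne : T.Nonempty) (hTA : ∀ b ∈ T, b ∈ A)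
    (hnet : ∀ a ∈ A, ∃ b ∈ T, L * ‖a - b‖ ≤ η)
    (hexp : T.card * Real.exp (-2 * N * (ι / 2) ^ 2) ≤ ε) :
    BCR.HoldsWithProbAtLeast (BCR.nestedSampleLaw P Q N M) (1 - 2 * ε)
      {ω | ∀ U : ℝ, BCR.IsBigM A F (fun i => (ω i).2) U →
        BCR.saaValue A F (fun i => (ω i).2) U (α + ι) - (δ : EReal) ≤ BCR.trueValue A F P Q α ∧
        BCR.trueValue A F P Q α ≤
          BCR.saaValue A F (fun i => (ω i).2) U (α - ι) + (δ : EReal) + (η : EReal)} := by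
  classical
  have hα0 : 0 < α := hι.trans hα
  set ν : Measure (Θ × (Fin M → Ξ)) := Q ⊗ₘ BCR.iidKernel P M with hν
  have hWr : ν.real W ≤ ι / 2 := ENNReal.toReal_le_of_le_ofReal (by positivity) hWp
  have hfst : ∀ S : Set Θ, MeasurableSet S → ν.real (Prod.fst ⁻¹' S) = Q.real S := by
    intro S hS
    rw [measureReal_def, measureReal_def, ← Measure.fst_apply hS, hν, Measure.fst_compProd]
  have hlevel : ∀ a ∈ A, ∀ κ : ℝ, MeasurableSet {θ | κ ≤ BCR.expectedCost F P a θ} :=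
    fun a ha κ => measurableSet_le measurable_const (measurable_expectedCost (hmeas a ha))
  obtain ⟨κ₀, a₁, ha₁, hκ₀, hopt⟩ := exists_near_optimal P Q hA hD hmeas hL hLip hα0
    (by linarith) (half_pos hδ)
  have hquant : ∀ b : EuclideanSpace ℝ (Fin n), ∃ c : ℝ, b ∈ A →
      ENNReal.ofReal α < Q {θ | c ≤ BCR.expectedCost F P b θ} ∧
      ∀ κ : ℝ, ENNReal.ofReal α < Q {θ | κ ≤ BCR.expectedCost F P b θ} → κ ≤ c + δ / 4 := by
    intro b
    by_cases hb : b ∈ A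
    · obtain ⟨c, hc⟩ := exists_near_quantile Q (measurable_expectedCost (P := P) (hmeas b hb))
        hα0 (by linarith) (by positivity : 0 < δ / 4)
      exact ⟨c, fun _ => hc⟩
    · exact ⟨0, fun h => absurd h hb⟩
  choose c hc using hquant
  -- `W` is counted pessimistically on each side: `E₀` has probability at most `α + ι / 2`, each `E
  -- b` at least `α - ι / 2`. Hoeffding's inequality spends the other `ι / 2`, applied to
  -- complements for `E b`.
  set E₀ : Set (Θ × (Fin M → Ξ)) :=
    Prod.fst ⁻¹' {θ | κ₀ ≤ BCR.expectedCost F P a₁ θ} ∪ W with hE₀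
  set E : EuclideanSpace ℝ (Fin n) → Set (Θ × (Fin M → Ξ)) := fun b =>
    Prod.fst ⁻¹' {θ | c b ≤ BCR.expectedCost F P b θ} \ W with hE
  have hE₀m : MeasurableSet E₀ := (measurable_fst (hlevel a₁ ha₁ κ₀)).union hW
  have hEm : ∀ b ∈ A, MeasurableSet (E b) := fun b hb =>
    (measurable_fst (hlevel b hb (c b))).diff hW
  have hE₀p : ν.real E₀ ≤ α + ι / 2 := by
    refine (measureReal_union_le _ _).trans (add_le_add ?_ hWr)
    rw [hfst _ (hlevel a₁ ha₁ κ₀)]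
    exact ENNReal.toReal_le_of_le_ofReal hα0.le hκ₀
  have hEp : ∀ b ∈ A, ν.real (E b)ᶜ ≤ 1 - α + ι / 2 := by
    intro b hb
    have hsub : (E b)ᶜ ⊆ Prod.fst ⁻¹' {θ | c b ≤ BCR.expectedCost F P b θ}ᶜ ∪ W := by
      intro ω hω
      by_cases h : ω ∈ W
      · exact Or.inr h
      · exact Or.inl fun h' => hω ⟨h', h⟩
    refine (measureReal_mono hsub).trans ((measureReal_union_le _ _).trans (add_le_add ?_ hWr))
    rw [hfst _ (hlevel b hb (c b)).compl, probReal_compl_eq_one_sub (hlevel b hb (c b))]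
    have : α ≤ Q.real {θ | c b ≤ BCR.expectedCost F P b θ} :=
      (ENNReal.ofReal_le_iff_le_toReal (measure_ne_top _ _)).1 (hc b hb).1.le
    linarith
  set X₀ : Set (Fin N → Θ × (Fin M → Ξ)) :=
    {ω | (α + ι / 2 + ι / 2) * N ≤ ∑ i, E₀.indicator (fun _ => (1 : ℝ)) (ω i)} with hX₀
  set X : EuclideanSpace ℝ (Fin n) → Set (Fin N → Θ × (Fin M → Ξ)) := fun b =>
    {ω | (1 - α + ι / 2 + ι / 2) * N ≤ ∑ i, (E b)ᶜ.indicator (fun _ => (1 : ℝ)) (ω i)} with hX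
  have hcountm : ∀ S : Set (Θ × (Fin M → Ξ)), MeasurableSet S →
      Measurable fun ω : Fin N → Θ × (Fin M → Ξ) =>
        ∑ i, S.indicator (fun _ => (1 : ℝ)) (ω i) := fun S hS =>
    Finset.measurable_sum _ fun i _ =>
      (measurable_const.indicator hS).comp (measurable_pi_apply i)
  have hbadm : MeasurableSet (X₀ ∪ ⋃ b ∈ T, X b) :=
    (measurableSet_le measurable_const (hcountm _ hE₀m)).union
      (Finset.measurableSet_biUnion _ fun b hb =>
        measurableSet_le measurable_const (hcountm _ (hEm b (hTA b hb)).compl))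
  have hlaw : BCR.nestedSampleLaw P Q N M = Measure.pi fun _ : Fin N => ν := rfl
  have hcard : (1 : ℝ) ≤ T.card := by exact_mod_cast hTne.card_pos
  have hbadp : (Measure.pi fun _ : Fin N => ν).real (X₀ ∪ ⋃ b ∈ T, X b) ≤ 2 * ε := by
    have h0 : (Measure.pi fun _ : Fin N => ν).real X₀ ≤ ε :=
      (measureReal_pi_le_sum_indicator_le ν hE₀m hE₀p (half_pos hι).le hN).trans
        ((le_mul_of_one_le_left (Real.exp_pos _).le hcard).trans hexp)
    have h1 : (Measure.pi fun _ : Fin N => ν).real (⋃ b ∈ T, X b) ≤ ε := by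
      refine (measureReal_biUnion_finset_le _ _).trans ((Finset.sum_le_sum fun b hb =>
        measureReal_pi_le_sum_indicator_le ν (hEm b (hTA b hb)).compl (hEp b (hTA b hb))
          (half_pos hι).le hN).trans ?_)
      rwa [Finset.sum_const, nsmul_eq_mul]
    linarith [measureReal_union_le (μ := Measure.pi fun _ : Fin N => ν) X₀ (⋃ b ∈ T, X b)]
  refine ⟨(X₀ ∪ ⋃ b ∈ T, X b)ᶜ, hbadm.compl, fun ω hω U hU => ?_, ?_⟩
  swap
  · rw [hlaw, ENNReal.ofReal_le_iff_le_toReal (measure_ne_top _ _), ← measureReal_def,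
      probReal_compl_eq_one_sub hbadm]
    linarith
  have hω₀ : ∑ i, E₀.indicator (fun _ => (1 : ℝ)) (ω i) < (α + ι) * N := by
    by_contra! h
    refine hω (Or.inl ?_)
    rw [hX₀, Set.mem_ofPred_eq, add_assoc, add_halves]
    exact h
  have hωb : ∀ b ∈ T, (α - ι) * N < ∑ i, (E b).indicator (fun _ => (1 : ℝ)) (ω i) := by
    intro b hb
    by_contra! h
    refine hω (Or.inr (Set.mem_iUnion₂.2 ⟨b, hb, ?_⟩))
    rw [hX, Set.mem_ofPred_eq]
    have := sum_indicator_add_sum_indicator_compl (E b) ω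
    linarith
  constructor
  · have hsaa : BCR.saaValue A F (fun i => (ω i).2) U (α + ι) ≤ ((κ₀ + δ / 2 : ℝ) : EReal) := by
      refine saaValue_le hU ha₁ hN hα1 ((Finset.sum_le_sum fun i _ => ?_).trans hω₀.le)
      by_cases hi : ω i ∈ E₀
      · rw [Set.indicator_of_mem hi]
        exact Set.indicator_le_self' (fun _ _ => zero_le_one) _
      · rw [Set.indicator_of_notMem hi, Set.indicator_of_notMem]
        intro hgt
        have h1 : κ₀ + δ / 2 < BCR.sampleMean F (ω i).2 a₁ := hgt
        have h2 : ¬ κ₀ ≤ BCR.expectedCost F P a₁ (ω i).1 := fun h => hi (Or.inl h)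
        have h3 := (abs_le.1 (hdev (ω i) (fun h => hi (Or.inr h)) a₁ ha₁)).2
        linarith
    refine (EReal.sub_le_sub hsaa le_rfl).trans (le_trans (le_of_eq ?_) hopt)
    rw [← EReal.coe_sub]
    congr 1
    ring
  · have hfeas : BCR.trueValue A F P Q α - ((δ + η : ℝ) : EReal) ≤
        BCR.saaValue A F (fun i => (ω i).2) U (α - ι) := by
      refine le_sInf ?_
      rintro _ ⟨κ, ⟨a, ha, z, hz, hκ, hsum⟩, rfl⟩
      have hcount := sum_indicator_le_of_feasible hz hκ hsum
      rw [EReal.sub_le_iff_le_add (Or.inl (EReal.coe_ne_bot _)) (Or.inl (EReal.coe_ne_top _)),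
        ← EReal.coe_add]
      obtain ⟨b, hb, hab⟩ := hnet a ha
      have hbA := hTA b hb
      refine sInf_le ⟨κ + (δ + η), ⟨b, hbA, ?_⟩, rfl⟩
      -- If `κ + δ + η` were infeasible at `b`, then `κ + δ + η ≤ c b + δ / 4`. Passing from `b` to
      -- `a` costs `η` and from expectation to sample mean `δ / 2`, so every sample in `E b` has
      -- mean above `κ` at `a`: more than `(α - ι)N` of them.
      by_contra! hgt
      have hcb := (hc b hbA).2 _ hgt
      refine absurd (hωb b hb) (not_lt.2 (le_trans (Finset.sum_le_sum fun i _ => ?_) hcount))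
      by_cases hi : ω i ∈ E b
      · rw [Set.indicator_of_mem hi, Set.indicator_of_mem]
        have h1 : c b ≤ BCR.expectedCost F P b (ω i).1 := hi.1
        have h2 := (abs_le.1 (hdev (ω i) hi.2 a ha)).1
        have h3 := (abs_le.1 (hLip (ω i).1 a ha b hbA)).1
        show κ < BCR.sampleMean F (ω i).2 a
        linarith
      · rw [Set.indicator_of_notMem hi]
        exact Set.indicator_nonneg (fun _ _ => zero_le_one) _
    rw [EReal.sub_le_iff_le_add (Or.inl (EReal.coe_ne_bot _)) (Or.inl (EReal.coe_ne_top _)),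
      EReal.coe_add, ← add_assoc] at hfeas
    exact hfeas

theorem mainTheorem11
    {S Θ Ξ : Type*} [MeasurableSpace Θ] [MeasurableSpace Ξ] {n k : ℕ}
    (C : S → EuclideanSpace ℝ (Fin n) → Ξ → ℝ)
    (g : S → EuclideanSpace ℝ (Fin n) → Ξ → S)
    (V : S → ProbabilityMeasure Θ → ℝ)
    (μ : EuclideanSpace ℝ (Fin k) → ProbabilityMeasure Θ)
    (H : Ξ → EuclideanSpace ℝ (Fin k))
    (Rep : EuclideanSpace ℝ (Fin k) → EuclideanSpace ℝ (Fin k))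
    (γ : ℝ)
    (P : Kernel Θ Ξ) [IsMarkovKernel P]
    (A : Set (EuclideanSpace ℝ (Fin n))) (hA : A.Nonempty)
    (s : S) (h : EuclideanSpace ℝ (Fin k))
    -- the objective is measurable in `ξ`, with finite second moment under every `P_θ`
    (hmeas : ∀ a ∈ A, Measurable (BCR.stageCost C g V μ H Rep γ s h a))
    (hsq : ∀ a ∈ A, ∀ θ, MemLp (BCR.stageCost C g V μ H Rep γ s h a) 2 (P θ))
    -- the expected cost is `L`-Lipschitz in `a`, uniformly in `θ`
    (L : ℝ) (hL : 0 ≤ L)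
    (hLip : ∀ θ, ∀ a₁ ∈ A, ∀ a₂ ∈ A,
      |BCR.expectedCost (BCR.stageCost C g V μ H Rep γ s h) P a₁ θ
        - BCR.expectedCost (BCR.stageCost C g V μ H Rep γ s h) P a₂ θ| ≤ L * ‖a₁ - a₂‖)
    -- the cost is `φ(ξ)`-Lipschitz in `a`, and `φ(ξ)` has a finite moment generating function
    -- in a neighbourhood of `0` under every `P_θ`
    (φ : Ξ → ℝ) (hφ : Measurable φ) (hφ0 : ∀ ξ, 0 ≤ φ ξ)
    (hφLip : ∀ ξ, ∀ a₁ ∈ A, ∀ a₂ ∈ A,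
      |BCR.stageCost C g V μ H Rep γ s h a₁ ξ - BCR.stageCost C g V μ H Rep γ s h a₂ ξ|
        ≤ φ ξ * ‖a₁ - a₂‖)
    (hmgf : ∀ θ, (0 : ℝ) ∈ interior (integrableExpSet φ (P θ)))
    (ι : ℝ) (hι : 0 < ι) :
    ∃ ς > (0 : ℝ), ∃ υ > (0 : ℝ),
      ∀ D : ℝ, (∀ a ∈ A, ‖a‖ ≤ D) →
      ∀ α : ℝ, ι < α → α + ι < 1 →
      ∀ ε ∈ Set.Ioo (0 : ℝ) 1, ∀ ε' ∈ Set.Ioo (0 : ℝ) 1, ∀ η > (0 : ℝ), ∀ δ > (0 : ℝ),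
      ∀ N M : ℕ, BCR.outerSampleSize n L D η ι ε ≤ N → BCR.innerSampleSize n ς υ D δ ε' ≤ M →
        BCR.HoldsWithProbAtLeast (BCR.nestedSampleLaw P (μ h : Measure Θ) N M)
          (1 - 2 * ε - 2 * ε')
          {ω | ∀ U : ℝ,
            BCR.IsBigM A (BCR.stageCost C g V μ H Rep γ s h) (fun i => (ω i).2) U →
              BCR.saaValue A (BCR.stageCost C g V μ H Rep γ s h) (fun i => (ω i).2) U (α + ι)
                  - (δ : EReal)
                ≤ BCR.trueValue A (BCR.stageCost C g V μ H Rep γ s h) P (μ h : Measure Θ) α ∧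
              BCR.trueValue A (BCR.stageCost C g V μ H Rep γ s h) P (μ h : Measure Θ) α
                ≤ BCR.saaValue A (BCR.stageCost C g V μ H Rep γ s h) (fun i => (ω i).2) U (α - ι)
                  + (δ : EReal) + (η : EReal)} := by
  set F := BCR.stageCost C g V μ H Rep γ s h
  by_cases hbdd : ∃ R : ℝ, ∀ a ∈ A, ‖a‖ ≤ R
  swap
  -- For unbounded `A` no `D` qualifies.
  · exact ⟨1, one_pos, 1, one_pos, fun D hD => absurd ⟨D, hD⟩ hbdd⟩
  obtain ⟨R, hR⟩ := hbdd
  obtain ⟨B, hB, hunif⟩ := exists_uniform_deviation_bound P (μ h : Measure Θ) hA hR hmeas hsq hL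
    hLip hφ hφ0 hφLip hmgf (half_pos hι)
  -- `B` comes from an auxiliary radius `R` and from `ι`, before `D`, `α` and the tolerances are
  -- introduced.
  refine ⟨B, hB, 1, one_pos, ?_⟩
  intro D hD α hα hα1 ε hε ε' hε' η hη δ hδ N M hN hM
  -- For `ε' ≥ 1 / 2` the claimed probability is nonpositive; otherwise `log (1 / ε')` is bounded
  -- away from `0`.
  rcases le_or_gt (1 / 2) ε' with hhalf | hhalf
  · refine ⟨∅, MeasurableSet.empty, Set.empty_subset _, ?_⟩
    rw [ENNReal.ofReal_of_nonpos (by linarith [hε.1])]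
    exact zero_le
  obtain ⟨a₀, ha₀⟩ := hA
  have hD0 : 0 ≤ D := (norm_nonneg _).trans (hD a₀ ha₀)
  obtain ⟨hMpos, hBM⟩ := div_sqrt_le_half_of_innerSampleSize_le hB hD0 hδ hε'.1 hhalf hM
  obtain ⟨W, hWm, hWp, hdev⟩ := hunif M hMpos
  obtain ⟨T, hTne, hTA, hnet, hcard⟩ := exists_finset_lipschitz_net hL hη hι (by linarith) A
    ⟨a₀, ha₀⟩ hD
  obtain ⟨hNpos, hexp⟩ := mul_exp_le_of_outerSampleSize_le hι hε.1 hε.2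
    (by exact_mod_cast hTne.card_pos) hcard hN
  obtain ⟨B', hB', hsub, hprob⟩ := holdsWithProbAtLeast_saaValue P (μ h : Measure Θ) ⟨a₀, ha₀⟩ hD
    hmeas hL hLip hι hα hα1 hδ hNpos hWm hWp
    (fun ω hω a ha => (hdev ω hω a ha).trans hBM) hTne hTA hnet hexp
  exact ⟨B', hB', hsub,
    (ENNReal.ofReal_le_ofReal (by linarith [hε'.1])).trans hprob⟩
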